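/- **Setting.** A *graphon* $(W,S,\mu)$ consists of a $\sigma$-finite measure space $(S,\mu)$ and a symmetric integrable function $W:S\times S\to\mathbb R$. A *trivial extension* of $(W,S,\mu)$ is a graphon $(\tilde W,\tilde S,\tilde\mu)$ such that $(S,\mu)$ is a measurable subspace of $(\tilde S,\tilde\mu)$ (with the restricted measure), $\tilde W=W$ on $S\times S$ and $\tilde W=0$ elsewhere. For $F\in L^1(S\times S,\mu\times\mu)$ the cut norm is $\|F\|_\square=\sup_{T,U}\bigl|\int_{T\times U}F\,d\mu\,d\mu\bigr|$, over measurable $T,U\subseteq S$. Let $(W_1,S_1,\mu_1)$ and $(W_2,S_2,\mu_2)$ be graphons. If $\mu_1(S_1)=\mu_2(S_2)$, let $$\delta_\square(W_1,W_2)=\inf_{\rho}\|W_1^{\pi_1}-W_2^{\pi_2}\|_{\square},\qquad \delta_p(W_1,W_2)=\inf_{\rho}\|W_1^{\pi_1}-W_2^{\pi_2}\|_{L^p}\quad(1\le p<\infty),$$ where $\rho$ runs over all measures on $S_1\times S_2$ with marginals $\mu_1$ and $\mu_2$, the norms are taken on $(S_1\times S_2,\rho)$ (so $L^p=L^p(\rho\times\rho)$),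 and $W_i^{\pi_i}\bigl((x_1,x_2),(y_1,y_2)\bigr)=W_i(x_i,y_i)$. If $\mu_1(S_1)\ne\mu_2(S_2)$, the same definitions are applied to trivial extensions of $W_1$ and $W_2$ with equal total masses, namely those obtained by adjoining to each space a disjoint copy of $[0,\infty)$ with Lebesgue measure. For $p>1$ the distance $\delta_p$ is considered only for non-negative graphons in $L^p$. The graphons $W_1,W_2$ are *equivalent*, $W_1\cong W_2$, if $\delta_\square(W_1,W_2)=0$. They are *elementarily equivalent* if one of them is a.e. equal to a pull-back $(x,y)\mapsto W(\varphi(x),\varphi(y))$ of the other one, $W$, along a measure-preserving map $\varphi$ between the underlying spaces, or if one is a trivial extension of the other. **Theorem.** Let $1<p<\infty$ and let $W,W'$ be two (a.e.) non-negative graphons in $L^p$. Then the following are equivalent: 1. $W\cong W'$; 2. $\delta_\square(W,W')=0$; 3. $\delta_1(W,W')=0$; 4. there is a finite sequence of graphons $W=W_0,W_1,\dots,W_N=W'$ such that $W_{i-1}$ and $W_i$ are elementarily equivalent for $i=1,\dots,N$; 5. $\delta_p(W,W')=0$. -/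

import Mathlib

open MeasureTheory
open scoped ENNReal

universe u

/-- A graphon: a symmetric integrable real function on the square of a σ-finite measure space.
It need be neither bounded nor non-negative. -/
structure Graphon : Type (u + 1) where
  /-- the underlying set `S` -/
  carrier : Type u
  [measurableSpace : MeasurableSpace carrier]
  /-- the measure on `S` -/
  μ : Measure carrier
  [sigmaFinite : SigmaFinite μ]
  /-- the function `W : S × S → ℝ` -/
  toFun : carrier × carrier → ℝ
  symm : ∀ x y, toFun (x, y) = toFun (y, x)
  integrable : Integrable toFun (μ.prod μ)

namespace Graphon

attribute [instance] Graphon.measurableSpace Graphon.sigmaFinite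

/-- The product measure `μ × μ` on `S × S`. -/
noncomputable abbrev sqMeasure (W : Graphon.{u}) : Measure (W.carrier × W.carrier) :=
  W.μ.prod W.μ

/-- `IsTrivialExtension W' W`: the measure space of `W` is (up to the embedding `ι`) a measurable
subspace of that of `W'`, with the restricted measure, and `W'` is `W` on the square of this
subspace and `0` elsewhere. -/
def IsTrivialExtension (W' W : Graphon.{u}) : Prop :=
  ∃ ι : W.carrier → W'.carrier,
    MeasurableEmbedding ι ∧
    W.μ = W'.μ.comap ι ∧
    (∀ x y, W'.toFun (ι x, ι y) = W.toFun (x, y)) ∧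
    (∀ x y, x ∉ Set.range ι ∨ y ∉ Set.range ι → W'.toFun (x, y) = 0)

/-- `W₁` is almost everywhere the pull-back of `W₂` along a measure-preserving map `S₁ → S₂`. -/
def IsPullback (W₁ W₂ : Graphon.{u}) : Prop :=
  ∃ φ : W₁.carrier → W₂.carrier,
    MeasurePreserving φ W₁.μ W₂.μ ∧
    W₁.toFun =ᵐ[W₁.sqMeasure] fun z => W₂.toFun (φ z.1, φ z.2)

/-- Elementary equivalence: one graphon is a.e. a pull-back of the other, or one is a trivial
extension of the other. -/
def ElemEquiv (W₁ W₂ : Graphon.{u}) : Prop :=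
  (IsPullback W₁ W₂ ∨ IsPullback W₂ W₁) ∨ (IsTrivialExtension W₁ W₂ ∨ IsTrivialExtension W₂ W₁)

/-- The cut norm `sup_{T,U} |∫_{T × U} F d(μ × μ)|`, over measurable `T`, `U`. -/
noncomputable def cutNorm {X : Type u} [MeasurableSpace X] (μ : Measure X) (F : X × X → ℝ) :
    ℝ≥0∞ :=
  ⨆ (T : Set X) (_ : MeasurableSet T) (U : Set X) (_ : MeasurableSet U),
    ‖∫ z in T ×ˢ U, F z ∂(μ.prod μ)‖ₑ

/-- The `L^p` norm on `(X × X, μ × μ)`. -/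
noncomputable def sqLpNorm (p : ℝ≥0∞) {X : Type u} [MeasurableSpace X] (μ : Measure X)
    (F : X × X → ℝ) : ℝ≥0∞ :=
  eLpNorm F p (μ.prod μ)

/-- `ρ` is a coupling measure of `μ₁` and `μ₂`: its marginals are `μ₁` and `μ₂`. (It is then
automatically σ-finite if `μ₁` or `μ₂` is.) -/
structure IsCouplingMeasure {S T : Type u} [MeasurableSpace S] [MeasurableSpace T]
    (ρ : Measure (S × T)) (μ₁ : Measure S) (μ₂ : Measure T) : Prop where
  map_fst : ρ.map Prod.fst = μ₁
  map_snd : ρ.map Prod.snd = μ₂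

/-- The difference `W₁^{π₁} - W₂^{π₂}` of the pull-backs of `W₁`, `W₂` along the projections of
`S₁ × S₂`. -/
def pullbackDiff (W₁ W₂ : Graphon.{u}) :
    (W₁.carrier × W₂.carrier) × (W₁.carrier × W₂.carrier) → ℝ :=
  fun z => W₁.toFun (z.1.1, z.2.1) - W₂.toFun (z.1.2, z.2.2)

/-- The infimum, over all coupling measures `ρ` of the underlying measures, of the norm `N` of
`W₁^{π₁} - W₂^{π₂}` on `(S₁ × S₂, ρ)`. -/
noncomputable def couplingInf
    (N : ∀ {X : Type u} [MeasurableSpace X], Measure X → (X × X → ℝ) → ℝ≥0∞)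
    (W₁ W₂ : Graphon.{u}) : ℝ≥0∞ :=
  ⨅ (ρ : Measure (W₁.carrier × W₂.carrier)) (_ : IsCouplingMeasure ρ W₁.μ W₂.μ),
    N ρ (pullbackDiff W₁ W₂)

/-- The half-line `[0, ∞)`. -/
abbrev HalfLine : Type := Set.Ici (0 : ℝ)

/-- Lebesgue measure on the half-line. -/
noncomputable def lebHalfLine : Measure HalfLine :=
  (volume : Measure ℝ).comap Subtype.val

/-- The disjoint union of a measure space with the half-line `[0, ∞)` with Lebesgue measure. -/
noncomputable def addHalfLineMeasure {S : Type u} [MeasurableSpace S] (μ : Measure S) :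
    Measure (S ⊕ HalfLine) :=
  μ.map Sum.inl + lebHalfLine.map Sum.inr

lemma embInl {S : Type u} [MeasurableSpace S] :
    MeasurableEmbedding (Sum.inl : S → S ⊕ HalfLine) :=
  ⟨Sum.inl_injective, measurable_inl, fun _ hs => MeasurableSet.inl_image hs⟩

lemma embInr {S : Type u} [MeasurableSpace S] :
    MeasurableEmbedding (Sum.inr : HalfLine → S ⊕ HalfLine) :=
  ⟨Sum.inr_injective, measurable_inr, fun _ hs => MeasurableSet.inr_image hs⟩

instance instSigmaFiniteHalfLine : SigmaFinite lebHalfLine := by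
  refine SigmaFinite.of_map _ (f := (Subtype.val : HalfLine → ℝ))
    measurable_subtype_coe.aemeasurable ?_
  rw [lebHalfLine, map_comap_subtype_coe measurableSet_Ici]
  infer_instance

instance instSigmaFiniteAddHalfLine {S : Type u} [MeasurableSpace S] (μ : Measure S)
    [SigmaFinite μ] : SigmaFinite (addHalfLineMeasure μ) := by
  have h1 := (embInl (S := S)).sigmaFinite_map (μ := μ)
  have h2 := (embInr (S := S)).sigmaFinite_map (μ := lebHalfLine)
  unfold addHalfLineMeasure
  infer_instance

/-- Extension by zero of a function on `S × S` to the square of `S ⊕ [0, ∞)`. -/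
def extendFun {S : Type u} (f : S × S → ℝ) : (S ⊕ HalfLine) × (S ⊕ HalfLine) → ℝ
  | (Sum.inl x, Sum.inl y) => f (x, y)
  | _ => 0

lemma integrable_extendFun {S : Type u} [MeasurableSpace S] (μ : Measure S) [SigmaFinite μ]
    {f : S × S → ℝ} (hf : Integrable f (μ.prod μ)) :
    Integrable (extendFun f) ((addHalfLineMeasure μ).prod (addHalfLineMeasure μ)) := by
  have e1 := embInl (S := S)
  have e2 := embInr (S := S)
  have h1 := e1.sigmaFinite_map (μ := μ)
  have h2 := e2.sigmaFinite_map (μ := lebHalfLine)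
  unfold addHalfLineMeasure
  rw [Measure.prod_add, Measure.add_prod, Measure.add_prod,
    Measure.map_prod_map _ _ e1.measurable e1.measurable,
    Measure.map_prod_map _ _ e2.measurable e1.measurable,
    Measure.map_prod_map _ _ e1.measurable e2.measurable,
    Measure.map_prod_map _ _ e2.measurable e2.measurable]
  simp only [integrable_add_measure]
  refine ⟨⟨?_, ?_⟩, ?_, ?_⟩
  · exact (e1.prodMap e1).integrable_map_iff.2 hf
  · exact (e2.prodMap e1).integrable_map_iff.2 (integrable_zero _ _ _)
  · exact (e1.prodMap e2).integrable_map_iff.2 (integrable_zero _ _ _)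
  · exact (e2.prodMap e2).integrable_map_iff.2 (integrable_zero _ _ _)

/-- The trivial extension of `W` obtained by adjoining a disjoint half-line `[0, ∞)` with Lebesgue
measure to the underlying space; its total mass is infinite. -/
noncomputable def addHalfLine (W : Graphon.{u}) : Graphon.{u} where
  carrier := W.carrier ⊕ HalfLine
  μ := addHalfLineMeasure W.μ
  toFun := extendFun W.toFun
  symm := by
    rintro (x | x) (y | y)
    · exact W.symm x y
    all_goals rfl
  integrable := integrable_extendFun W.μ W.integrable

lemma isTrivialExtension_addHalfLine (W : Graphon.{u}) :
    IsTrivialExtension W.addHalfLine W := by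
  refine ⟨(Sum.inl : W.carrier → W.carrier ⊕ HalfLine), embInl, ?_, fun x y => rfl, ?_⟩
  · ext s hs
    change _ = (addHalfLineMeasure W.μ).comap Sum.inl s
    have h0 : (Sum.inr : HalfLine → W.carrier ⊕ HalfLine) ⁻¹' (Sum.inl '' s) = ∅ := by
      ext x; simp
    rw [embInl.comap_apply, addHalfLineMeasure, Measure.add_apply, embInl.map_apply,
      embInr.map_apply, h0, Set.preimage_image_eq _ Sum.inl_injective]
    simp
  · rintro (x | x) (y | y) h
    · exact absurd h (not_or.2 ⟨not_not.2 ⟨x, rfl⟩, not_not.2 ⟨y, rfl⟩⟩)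
    all_goals rfl

lemma addHalfLine_univ (W : Graphon.{u}) : W.addHalfLine.μ Set.univ = ⊤ := by
  change addHalfLineMeasure W.μ Set.univ = ⊤
  rw [addHalfLineMeasure, Measure.add_apply, embInr.map_apply, Set.preimage_univ, lebHalfLine,
    comap_subtype_coe_apply measurableSet_Ici, Set.image_univ, Subtype.range_coe, Real.volume_Ici,
    add_top]

open Classical in
/-- The invariant distance attached to a norm `N`. If the two spaces have the same total mass it is
the infimum over couplings; otherwise `W₁` and `W₂` are first replaced by trivial extensions of
equal total mass, here those that adjoin a half-line to both spaces. -/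
noncomputable def invariantDist
    (N : ∀ {X : Type u} [MeasurableSpace X], Measure X → (X × X → ℝ) → ℝ≥0∞)
    (W₁ W₂ : Graphon.{u}) : ℝ≥0∞ :=
  if W₁.μ Set.univ = W₂.μ Set.univ then couplingInf N W₁ W₂
  else couplingInf N W₁.addHalfLine W₂.addHalfLine

/-- The cut metric `δ_□`. -/
noncomputable def cutDist (W₁ W₂ : Graphon.{u}) : ℝ≥0∞ :=
  invariantDist cutNorm W₁ W₂

/-- The invariant `L^p` metric `δ_p`. -/
noncomputable def lpDist (p : ℝ≥0∞) (W₁ W₂ : Graphon.{u}) : ℝ≥0∞ :=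
  invariantDist (sqLpNorm p) W₁ W₂

/-- Two graphons are equivalent if their cut distance vanishes. -/
def Equivalent (W₁ W₂ : Graphon.{u}) : Prop :=
  cutDist W₁ W₂ = 0

/-- `W` and `W'` are joined by a finite sequence of graphons `W = W₀, …, W_N = W'` in which
consecutive members are elementarily equivalent. -/
def ElemChain (W W' : Graphon.{u}) : Prop :=
  ∃ (N : ℕ) (V : ℕ → Graphon.{u}),
    V 0 = W ∧ V N = W' ∧ ∀ i < N, ElemEquiv (V i) (V (i + 1))

end Graphon

/-! A vanishing distance yields elementary equivalences by a compactness argument; elementary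
equivalences yield vanishing distances by a gluing argument. The underlying spaces need not be
standard Borel, so disintegration is avoided in both directions.

From distance zero to a chain. Every graphon is a pull-back of one on the cube `CodeSpace`, along a
map that records the cells of a sequence of step approximations together with a positive integrable
weight (`exists_standardization`, `exists_code`). Couplings along which the norm of the difference
tends to zero are pushed to the square of the cube and multiplied by the sum of the two normalised
weights. They become probability measures on a compact space, so they have a limit `Q` along an
ultrafilter, and `Q` divided by the weight is the limit coupling (`exists_limit_coupling`). Mass may
escape to points where one weight is zero, hence the limit has the right marginals only over the
points of non-zero weight. The two kernels agree a.e. under it, and such a partial coupling is a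
chain of pull-backs and trivial extensions (`linked_of_partialCoupling`). All that is needed of the
norms is that the difference integrates to zero in the limit against products of functions that are
bounded and have bounded integrals: the cut norm controls these through rectangles, the `L^p` norm
through Hölder. No comparison between `δ_p` and `δ_1` is required.

From a chain to distance zero, for any finite exponent at least one. Trivial extensions change the
total mass, so distances are first measured on the essential parts, where null rows are discarded
(`EssDistZero`). Each elementary equivalence identifies the essential parts. Transitivity holds
because two couplings can be glued over the cells of a step approximation of the middle graphon,
with an arbitrarily small error (`EssDistZero.trans`). Finally, a coupling of essential parts is cut
down to finite mass and completed by an arbitrary coupling of what is left of the two spaces; the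
kernels are small in `L^r` outside the retained square, so the completion costs little
(`exists_coupling_of_essDistZero`). -/

namespace MeasureTheory

open Set

/-! ### Gluing measures over a countable quotient -/

section Gluing

variable {X Y : Type*} [MeasurableSpace X] [MeasurableSpace Y]

lemma sum_restrict_fibers (μ : Measure X) {a : X → ℕ} (ha : Measurable a) :
    Measure.sum (fun n => μ.restrict (a ⁻¹' {n})) = μ := by
  rw [← Measure.restrict_iUnion, ← preimage_iUnion, iUnion_of_singleton, preimage_univ,
    Measure.restrict_univ]
  · exact fun i j hij => Disjoint.preimage _ (by simpa using hij)
  · exact fun n => ha (measurableSet_singleton n)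

/-- Two measures with the same image on a countable space can be coupled over that space. -/
lemma exists_coupling_over_nat {μ : Measure X} {ν : Measure Y} {a : X → ℕ} {b : Y → ℕ}
    (ha : Measurable a) (hb : Measurable b) (hab : μ.map a = ν.map b)
    (hfin : ∀ n, μ (a ⁻¹' {n}) ≠ ∞) :
    ∃ Θ : Measure (X × Y), Θ.map Prod.fst = μ ∧ Θ.map Prod.snd = ν ∧
      ∀ᵐ z ∂Θ, a z.1 = b z.2 := by
  have hm : ∀ n, μ (a ⁻¹' {n}) = ν (b ⁻¹' {n}) := fun n => by
    rw [← Measure.map_apply ha (measurableSet_singleton n), hab,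
      Measure.map_apply hb (measurableSet_singleton n)]
  have hA : ∀ n, MeasurableSet (a ⁻¹' {n}) := fun n => ha (measurableSet_singleton n)
  have hB : ∀ n, MeasurableSet (b ⁻¹' {n}) := fun n => hb (measurableSet_singleton n)
  have hf1 : ∀ n, IsFiniteMeasure (μ.restrict (a ⁻¹' {n})) := fun n =>
    isFiniteMeasure_restrict.2 (hfin n)
  have hf2 : ∀ n, IsFiniteMeasure (ν.restrict (b ⁻¹' {n})) := fun n =>
    isFiniteMeasure_restrict.2 (hm n ▸ hfin n)
  have hs1 : SFinite μ := by
    rw [← sum_restrict_fibers μ ha]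
    infer_instance
  have hs2 : SFinite ν := by
    rw [← sum_restrict_fibers ν hb]
    infer_instance
  -- Normalised product measure on each fibre. A null fibre gets the factor `0⁻¹ = ∞`, which is
  -- harmless because the product there is the zero measure.
  refine ⟨Measure.sum fun n => (μ (a ⁻¹' {n}))⁻¹ •
    (μ.restrict (a ⁻¹' {n})).prod (ν.restrict (b ⁻¹' {n})), ?_, ?_, ?_⟩
  · rw [Measure.map_sum measurable_fst.aemeasurable]
    conv_rhs => rw [← sum_restrict_fibers μ ha]
    congr 1; ext1 n
    rw [Measure.map_smul, Measure.map_fst_prod, Measure.restrict_apply_univ, ← hm n, smul_smul]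
    by_cases h0 : μ (a ⁻¹' {n}) = 0
    · rw [Measure.restrict_eq_zero.2 h0, smul_zero]
    · rw [ENNReal.inv_mul_cancel h0 (hfin n), one_smul]
  · rw [Measure.map_sum measurable_snd.aemeasurable]
    conv_rhs => rw [← sum_restrict_fibers ν hb]
    congr 1; ext1 n
    rw [Measure.map_smul, Measure.map_snd_prod, Measure.restrict_apply_univ, smul_smul]
    by_cases h0 : μ (a ⁻¹' {n}) = 0
    · rw [Measure.restrict_eq_zero.2 (hm n ▸ h0), smul_zero]
    · rw [ENNReal.inv_mul_cancel h0 (hfin n), one_smul]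
  · have hmeas : MeasurableSet {z : X × Y | a z.1 = b z.2} :=
      measurableSet_eq_fun (ha.comp measurable_fst) (hb.comp measurable_snd)
    rw [Measure.ae_sum_iff' hmeas]
    intro n
    refine Measure.ae_smul_measure ?_ _
    rw [Measure.prod_restrict]
    filter_upwards [ae_restrict_mem ((hA n).prod (hB n))] with z hz
    have h1 : a z.1 = n := hz.1
    have h2 : b z.2 = n := hz.2
    rw [h1, h2]

end Gluing

/-! ### Couplings of σ-finite measures of equal mass -/

section Coupling

/-- The half-open intervals between consecutive partial sums of a sequence of finite numbers. -/
def sumInterval (c : ℕ → ℝ≥0∞) (n : ℕ) : Set ℝ :=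
  {t | 0 ≤ t ∧ ∑ k ∈ Finset.range n, c k ≤ ENNReal.ofReal t ∧
    ENNReal.ofReal t < ∑ k ∈ Finset.range (n + 1), c k}

lemma measurableSet_sumInterval (c : ℕ → ℝ≥0∞) (n : ℕ) : MeasurableSet (sumInterval c n) :=
  measurableSet_Ici.inter ((measurableSet_le measurable_const ENNReal.measurable_ofReal).inter
    (measurableSet_lt ENNReal.measurable_ofReal measurable_const))

lemma disjoint_sumInterval (c : ℕ → ℝ≥0∞) :
    Pairwise (Function.onFun Disjoint (sumInterval c)) := by
  have hmono : Monotone fun n => ∑ k ∈ Finset.range n, c k := fun i j h =>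
    Finset.sum_le_sum_of_subset (Finset.range_mono h)
  have key : ∀ i j, i < j → Disjoint (sumInterval c i) (sumInterval c j) := fun i j h =>
    Set.disjoint_left.2 fun t h1 h2 =>
      absurd (h1.2.2.trans_le ((hmono (Nat.succ_le_of_lt h)).trans h2.2.1)) (lt_irrefl _)
  intro i j hij
  rcases lt_or_gt_of_ne hij with h | h
  · exact key i j h
  · exact (key j i h).symm

/-- The union depends on the sequence only through its sum. Two sequences with equal sums, possibly
infinite, therefore partition the same part of the half-line. -/
lemma iUnion_sumInterval (c : ℕ → ℝ≥0∞) :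
    ⋃ n, sumInterval c n = {t | 0 ≤ t ∧ ENNReal.ofReal t < ∑' n, c n} := by
  ext t
  simp only [mem_iUnion, mem_ofPred_eq]
  constructor
  · rintro ⟨n, h0, -, h⟩
    exact ⟨h0, h.trans_le (ENNReal.sum_le_tsum _)⟩
  · rintro ⟨h0, h⟩
    classical
    rw [ENNReal.tsum_eq_iSup_nat, lt_iSup_iff] at h
    have hne : ∃ n, ENNReal.ofReal t < ∑ k ∈ Finset.range n, c k := h
    -- The least index whose partial sum exceeds `t` is positive since the empty sum is zero; its
    -- predecessor is the index of the interval.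
    obtain ⟨m, hm⟩ : ∃ m, Nat.find hne = m + 1 := by
      refine Nat.exists_eq_succ_of_ne_zero fun h0 => ?_
      have := Nat.find_spec hne
      rw [h0] at this
      simp at this
    refine ⟨m, h0, ?_, hm ▸ Nat.find_spec hne⟩
    exact not_lt.1 (Nat.find_min hne (by omega))

lemma volume_sumInterval {c : ℕ → ℝ≥0∞} (hc : ∀ n, c n ≠ ∞) (n : ℕ) :
    volume (sumInterval c n) = c n := by
  have h1 : ∑ k ∈ Finset.range n, c k ≠ ∞ := ENNReal.sum_ne_top.2 fun k _ => hc k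
  have h2 : ∑ k ∈ Finset.range (n + 1), c k ≠ ∞ := ENNReal.sum_ne_top.2 fun k _ => hc k
  have : sumInterval c n = Set.Ico (∑ k ∈ Finset.range n, c k).toReal
      (∑ k ∈ Finset.range (n + 1), c k).toReal := by
    ext t
    simp only [sumInterval, mem_ofPred_eq, mem_Ico]
    constructor
    · rintro ⟨h0, ha, hb⟩
      exact ⟨ENNReal.toReal_le_of_le_ofReal h0 ha, (ENNReal.ofReal_lt_iff_lt_toReal h0 h2).1 hb⟩
    · rintro ⟨ha, hb⟩
      have h0 : 0 ≤ t := ENNReal.toReal_nonneg.trans ha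
      exact ⟨h0, (ENNReal.le_ofReal_iff_toReal_le h1 h0).2 ha,
        (ENNReal.ofReal_lt_iff_lt_toReal h0 h2).2 hb⟩
  rw [this, Real.volume_Ico, ← ENNReal.toReal_sub_of_le _ h2, ENNReal.ofReal_toReal,
    Finset.sum_range_succ, ENNReal.add_sub_cancel_left h1]
  · exact ENNReal.sub_ne_top h2
  · exact Finset.sum_le_sum_of_subset (Finset.range_mono n.le_succ)

/-- A σ-finite measure is a countable sum of multiples of probability measures. -/
lemma exists_sum_smul_prob {X : Type*} [MeasurableSpace X] (μ : Measure X) [SigmaFinite μ] :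
    ∃ (c : ℕ → ℝ≥0∞) (P : ℕ → Measure X), (∀ n, c n ≠ ∞) ∧ (∀ n, IsFiniteMeasure (P n)) ∧
      (∀ n, c n ≠ 0 → P n univ = 1) ∧ Measure.sum (fun n => c n • P n) = μ := by
  have hfin : ∀ n, μ (disjointed (spanningSets μ) n) ≠ ∞ := fun n =>
    ((measure_mono (disjointed_subset _ n)).trans_lt (measure_spanningSets_lt_top μ n)).ne
  have hms : ∀ n, MeasurableSet (disjointed (spanningSets μ) n) := fun n =>
    MeasurableSet.disjointed (measurableSet_spanningSets μ) n
  have hF : ∀ n, IsFiniteMeasure (μ.restrict (disjointed (spanningSets μ) n)) := fun n =>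
    isFiniteMeasure_restrict.2 (hfin n)
  refine ⟨fun n => μ (disjointed (spanningSets μ) n),
    fun n => ProbabilityTheory.cond μ (disjointed (spanningSets μ) n), hfin, fun n => inferInstance,
    fun n hn => ?_, ?_⟩
  · have := ProbabilityTheory.cond_isProbabilityMeasure_of_finite hn (hfin n)
    exact measure_univ
  · have : ∀ n, μ (disjointed (spanningSets μ) n) •
        ProbabilityTheory.cond μ (disjointed (spanningSets μ) n) =
        μ.restrict (disjointed (spanningSets μ) n) := fun n => by
      rw [ProbabilityTheory.cond, smul_smul]
      by_cases h0 : μ (disjointed (spanningSets μ) n) = 0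
      · rw [Measure.restrict_eq_zero.2 h0, smul_zero]
      · rw [ENNReal.mul_inv_cancel h0 (hfin n), one_smul]
    simp_rw [this]
    rw [← Measure.restrict_iUnion (disjoint_disjointed _) hms, iUnion_disjointed,
      iUnion_spanningSets, Measure.restrict_univ]

lemma sum_smul_apply_univ {X : Type*} [MeasurableSpace X] {c : ℕ → ℝ≥0∞} {P : ℕ → Measure X}
    (hP : ∀ n, c n ≠ 0 → P n univ = 1) :
    Measure.sum (fun n => c n • P n) univ = ∑' n, c n := by
  rw [Measure.sum_apply _ MeasurableSet.univ]
  refine tsum_congr fun n => ?_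
  by_cases h0 : c n = 0
  · simp [h0]
  · simp [hP n h0]

/-- σ-finite measures of equal total mass have a coupling. -/
lemma exists_coupling {X Y : Type*} [MeasurableSpace X] [MeasurableSpace Y] (μ : Measure X)
    (ν : Measure Y) [SigmaFinite μ] [SigmaFinite ν] (h : μ univ = ν univ) :
    ∃ ρ : Measure (X × Y), ρ.map Prod.fst = μ ∧ ρ.map Prod.snd = ν := by
  obtain ⟨c, P, hc, hP, hP1, rfl⟩ := exists_sum_smul_prob μ
  obtain ⟨d, Q, hd, hQ, hQ1, rfl⟩ := exists_sum_smul_prob ν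
  rw [sum_smul_apply_univ hP1, sum_smul_apply_univ hQ1] at h
  have hU : ⋃ n, sumInterval c n = ⋃ n, sumInterval d n := by
    rw [iUnion_sumInterval, iUnion_sumInterval, h]
  have hrow : ∀ (c d : ℕ → ℝ≥0∞), (∀ n, c n ≠ ∞) →
      ⋃ n, sumInterval c n = ⋃ n, sumInterval d n → ∀ n,
      ∑' m, volume (sumInterval c n ∩ sumInterval d m) = c n := by
    intro c d hc hU n
    rw [← measure_iUnion, ← inter_iUnion, ← hU, inter_eq_left.2 (subset_iUnion _ n),
      volume_sumInterval hc]
    · exact fun i j hij => (disjoint_sumInterval d hij).mono inter_subset_right inter_subset_right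
    · exact fun m => (measurableSet_sumInterval c n).inter (measurableSet_sumInterval d m)
  have hz1 : ∀ n m, volume (sumInterval c n ∩ sumInterval d m) ≠ 0 → P n univ = 1 := by
    intro n m hnm
    refine hP1 n fun h0 => hnm (measure_mono_null inter_subset_left ?_)
    rw [volume_sumInterval hc, h0]
  have hz2 : ∀ n m, volume (sumInterval c n ∩ sumInterval d m) ≠ 0 → Q m univ = 1 := by
    intro n m hnm
    refine hQ1 m fun h0 => hnm (measure_mono_null inter_subset_right ?_)
    rw [volume_sumInterval hd, h0]
  -- The overlap lengths of the two interval partitions form a matrix with row sums `c` and column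
  -- sums `d`, that is, a coupling of the weights; each entry is spread out as a product of
  -- probability measures.
  refine ⟨Measure.sum fun n => Measure.sum fun m =>
    volume (sumInterval c n ∩ sumInterval d m) • (P n).prod (Q m), ?_, ?_⟩
  · rw [Measure.map_sum measurable_fst.aemeasurable]
    congr 1; ext1 n
    rw [Measure.map_sum measurable_fst.aemeasurable]
    ext s hs
    rw [Measure.sum_apply _ hs, Measure.smul_apply, smul_eq_mul, ← hrow c d hc hU n,
      ← ENNReal.tsum_mul_right]
    refine tsum_congr fun m => ?_
    rw [Measure.map_smul, Measure.map_fst_prod, smul_smul, Measure.smul_apply, smul_eq_mul]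
    by_cases h0 : volume (sumInterval c n ∩ sumInterval d m) = 0
    · simp [h0]
    · rw [hz2 n m h0, mul_one]
  · rw [Measure.sum_comm, Measure.map_sum measurable_snd.aemeasurable]
    congr 1; ext1 m
    rw [Measure.map_sum measurable_snd.aemeasurable]
    ext s hs
    rw [Measure.sum_apply _ hs, Measure.smul_apply, smul_eq_mul, ← hrow d c hd hU.symm m,
      ← ENNReal.tsum_mul_right]
    refine tsum_congr fun n => ?_
    rw [Measure.map_smul, Measure.map_snd_prod, smul_smul, Measure.smul_apply, smul_eq_mul,
      inter_comm (sumInterval d m)]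
    by_cases h0 : volume (sumInterval c n ∩ sumInterval d m) = 0
    · simp [h0]
    · rw [hz1 n m h0, mul_one]

end Coupling

/-! ### Density of step functions with countably many cells -/

section StepApproximation

variable {S : Type*} [MeasurableSpace S]

/-- A function on `S × S` is a step function for `μ` if it is constant on the rectangles of a
countable measurable partition of `S` into sets of finite measure. -/
def IsStep (μ : Measure S) (f : S × S → ℝ) : Prop :=
  ∃ (a : S → ℕ) (c : ℕ × ℕ → ℝ), Measurable a ∧ (∀ n, μ (a ⁻¹' {n}) ≠ ∞) ∧
    f = fun z => c (a z.1, a z.2)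

/-- The sets whose indicator is a step function. -/
def stepSets (μ : Measure S) : Set (Set (S × S)) :=
  {t | ∃ (a : S → ℕ) (C : Set (ℕ × ℕ)), Measurable a ∧ (∀ n, μ (a ⁻¹' {n}) ≠ ∞) ∧
    t = (fun z : S × S => (a z.1, a z.2)) ⁻¹' C}

lemma measurable_pair_nat {a b : S → ℕ} (ha : Measurable a) (hb : Measurable b) :
    Measurable fun x => Nat.pair (a x) (b x) :=
  (Measurable.of_discrete (f := fun p : ℕ × ℕ => Nat.pair p.1 p.2)).comp (ha.prodMk hb)

lemma measure_pair_fiber_ne_top {μ : Measure S} {a : S → ℕ} (ha : ∀ n, μ (a ⁻¹' {n}) ≠ ∞)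
    (b : S → ℕ) (n : ℕ) : μ ((fun x => Nat.pair (a x) (b x)) ⁻¹' {n}) ≠ ∞ := by
  refine ((measure_mono fun x hx => ?_).trans_lt (ha (Nat.unpair n).1).lt_top).ne
  have hx' : Nat.pair (a x) (b x) = n := hx
  rw [← hx', mem_preimage, Nat.unpair_pair, mem_singleton_iff]

/-- `Nat.pair` indexes the common refinement of the two partitions; its cells have finite measure
because those of the first partition do. -/
lemma IsStep.add {μ : Measure S} {f g : S × S → ℝ} (hf : IsStep μ f) (hg : IsStep μ g) :
    IsStep μ (f + g) := by
  obtain ⟨a, c, ha, ha', rfl⟩ := hf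
  obtain ⟨b, d, hb, -, rfl⟩ := hg
  refine ⟨fun x => Nat.pair (a x) (b x), fun p => c ((Nat.unpair p.1).1, (Nat.unpair p.2).1) +
    d ((Nat.unpair p.1).2, (Nat.unpair p.2).2), measurable_pair_nat ha hb,
    measure_pair_fiber_ne_top ha' b, ?_⟩
  ext z
  simp

lemma IsStep.measurable {μ : Measure S} {f : S × S → ℝ} (hf : IsStep μ f) : Measurable f := by
  obtain ⟨a, c, ha, -, rfl⟩ := hf
  exact (Measurable.of_discrete (f := c)).comp
    ((ha.comp measurable_fst).prodMk (ha.comp measurable_snd))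

lemma exists_partition_nat (μ : Measure S) [SigmaFinite μ] :
    ∃ a : S → ℕ, Measurable a ∧ ∀ n, μ (a ⁻¹' {n}) ≠ ∞ := by
  refine ⟨spanningSetsIndex μ, measurableSet_spanningSetsIndex μ, fun n => ?_⟩
  rw [preimage_spanningSetsIndex_singleton]
  exact ((measure_mono (disjointed_subset _ n)).trans_lt (measure_spanningSets_lt_top μ n)).ne

lemma isSetAlgebra_stepSets (μ : Measure S) [SigmaFinite μ] : IsSetAlgebra (stepSets μ) where
  empty_mem := by
    obtain ⟨a, ha, ha'⟩ := exists_partition_nat μ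
    exact ⟨a, ∅, ha, ha', rfl⟩
  compl_mem := by
    rintro _ ⟨a, C, ha, ha', rfl⟩
    exact ⟨a, Cᶜ, ha, ha', rfl⟩
  union_mem := by
    rintro _ _ ⟨a, C, ha, ha', rfl⟩ ⟨b, D, hb, -, rfl⟩
    refine ⟨fun x => Nat.pair (a x) (b x), {p | ((Nat.unpair p.1).1, (Nat.unpair p.2).1) ∈ C ∨
      ((Nat.unpair p.1).2, (Nat.unpair p.2).2) ∈ D}, measurable_pair_nat ha hb,
      measure_pair_fiber_ne_top ha' b, ?_⟩
    ext z
    simp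

lemma prod_mem_stepSets (μ : Measure S) [SigmaFinite μ] {A B : Set S} (hA : MeasurableSet A)
    (hB : MeasurableSet B) : A ×ˢ B ∈ stepSets μ := by
  classical
  obtain ⟨a, ha, ha'⟩ := exists_partition_nat μ
  -- Both membership bits are stored because one partition serves both variables; the first variable
  -- is read through the bit of `A`, the second through that of `B`.
  let b : S → ℕ := fun x => Nat.pair (if x ∈ A then 1 else 0) (if x ∈ B then 1 else 0)
  have hb : Measurable b := measurable_pair_nat (Measurable.ite hA measurable_const measurable_const)
    (Measurable.ite hB measurable_const measurable_const)
  refine ⟨fun x => Nat.pair (a x) (b x), {p | (Nat.unpair (Nat.unpair p.1).2).1 = 1 ∧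
    (Nat.unpair (Nat.unpair p.2).2).2 = 1}, measurable_pair_nat ha hb,
    measure_pair_fiber_ne_top ha' b, ?_⟩
  ext z
  simp [b]

lemma measurableSet_of_mem_stepSets {μ : Measure S} {t : Set (S × S)} (ht : t ∈ stepSets μ) :
    MeasurableSet t := by
  obtain ⟨a, C, ha, -, rfl⟩ := ht
  exact ((ha.comp measurable_fst).prodMk (ha.comp measurable_snd)) (MeasurableSet.of_discrete)

/-- These sets form an algebra that contains the rectangles, hence generates the product σ-algebra,
and squares of spanning sets exhaust the space by members of finite measure. -/
lemma measureDense_stepSets (μ : Measure S) [SigmaFinite μ] :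
    (μ.prod μ).MeasureDense (stepSets μ) := by
  refine Measure.MeasureDense.of_generateFrom_isSetAlgebra_sigmaFinite (isSetAlgebra_stepSets μ)
    ⟨fun n => spanningSets μ n ×ˢ spanningSets μ n, fun n => prod_mem_stepSets μ
      (measurableSet_spanningSets μ n) (measurableSet_spanningSets μ n), fun n => ?_, ?_⟩ ?_
  · rw [Measure.prod_prod]
    exact ENNReal.mul_lt_top (measure_spanningSets_lt_top μ n) (measure_spanningSets_lt_top μ n)
  · rw [iUnion_prod_of_monotone (monotone_spanningSets μ) (monotone_spanningSets μ),
      iUnion_spanningSets, univ_prod_univ]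
  · refine le_antisymm ?_ (MeasurableSpace.generateFrom_le fun t ht =>
      measurableSet_of_mem_stepSets ht)
    rw [← generateFrom_prod]
    refine MeasurableSpace.generateFrom_mono ?_
    rintro _ ⟨A, hA, B, hB, rfl⟩
    exact prod_mem_stepSets μ hA hB

/-- Step functions are dense in `L^q(μ × μ)`. -/
lemma MemLp.exists_isStep_eLpNorm_sub_le {μ : Measure S} [SigmaFinite μ] {q : ℝ≥0∞} (hq : q ≠ ∞)
    {f : S × S → ℝ} (hf : MemLp f q (μ.prod μ)) {ε : ℝ≥0∞} (hε : ε ≠ 0) :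
    ∃ g, IsStep μ g ∧ eLpNorm (f - g) q (μ.prod μ) ≤ ε := by
  suffices h : ∃ g : S × S → ℝ, eLpNorm (f - g) q (μ.prod μ) ≤ ε ∧ IsStep μ g by
    obtain ⟨g, h1, h2⟩ := h
    exact ⟨g, h2, h1⟩
  refine hf.induction_dense hq (IsStep μ) ?_ (fun f g => IsStep.add)
    (fun f hf => hf.measurable.aestronglyMeasurable) hε
  intro c s hs hμs ε hε
  obtain ⟨η, hη, hη'⟩ := exists_eLpNorm_indicator_le (μ := μ.prod μ) hq c hε
  obtain ⟨t, ht, hst⟩ := (measureDense_stepSets μ).approx s hs hμs.ne η (by exact_mod_cast hη)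
  refine ⟨t.indicator fun _ => c, ?_, ?_⟩
  · rw [eLpNorm_indicator_sub_indicator]
    refine hη' _ ?_
    rw [symmDiff_comm]
    simpa using hst.le
  · obtain ⟨a, C, ha, ha', rfl⟩ := ht
    exact ⟨a, C.indicator fun _ => c, ha, ha', rfl⟩

end StepApproximation

end MeasureTheory

namespace MeasureTheory

open Set Filter Topology TopologicalSpace
open scoped _root_.BoundedContinuousFunction
open scoped NNReal

/-! ### Limits of weighted couplings on compact spaces -/

section LimitCoupling

variable {X K : Type*} [MeasurableSpace X] [MeasurableSpace K]

/-- The measure `w⁻¹ P`, concentrated on `{w ≠ 0}`. -/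
noncomputable def divMeasure (P : Measure X) (w : X → ℝ≥0) : Measure X :=
  P.withDensity fun x => ((w x)⁻¹ : ℝ≥0)

lemma lintegral_divMeasure (P : Measure X) {w : X → ℝ≥0} (hw : Measurable w) {f : X → ℝ≥0∞}
    (hf : Measurable f) : ∫⁻ x, f x ∂(divMeasure P w) = ∫⁻ x, ((w x)⁻¹ : ℝ≥0) * f x ∂P :=
  lintegral_withDensity_eq_lintegral_mul _ hw.inv.coe_nnreal_ennreal hf

/-- If `μ = 0` on `{u = 0}` and `u ² μ` is the image of `(u ∘ π) ² ρ`, then `μ` is the image of the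
restriction of `ρ` to `{u ∘ π ≠ 0}`. -/
lemma map_restrict_eq_of_withDensity_eq {μ : Measure K} {ρ : Measure X} {π : X → K} {u : K → ℝ≥0}
    (hπ : Measurable π) (hu : Measurable u) (hμ : ∀ᵐ y ∂μ, u y ≠ 0)
    (h : μ.withDensity (fun y => ((u y ^ 2 : ℝ≥0) : ℝ≥0∞)) =
      (ρ.withDensity fun x => ((u (π x) ^ 2 : ℝ≥0) : ℝ≥0∞)).map π) :
    (ρ.restrict {x | u (π x) ≠ 0}).map π = μ := by
  have hE : MeasurableSet {x | u (π x) ≠ 0} := (hu.comp hπ) (measurableSet_singleton 0).compl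
  have hv : Measurable fun y => (((u y ^ 2)⁻¹ : ℝ≥0) : ℝ≥0∞) :=
    (hu.pow_const 2).inv.coe_nnreal_ennreal
  have hu2 : Measurable fun y => ((u y ^ 2 : ℝ≥0) : ℝ≥0∞) :=
    (hu.pow_const 2).coe_nnreal_ennreal
  have key : ∀ c : ℝ≥0, c ≠ 0 → ((c ^ 2 : ℝ≥0) : ℝ≥0∞) * (((c ^ 2)⁻¹ : ℝ≥0) : ℝ≥0∞) = 1 := by
    intro c hc
    rw [← ENNReal.coe_mul, mul_inv_cancel₀ (pow_ne_zero 2 hc), ENNReal.coe_one]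
  ext s hs
  -- The measure is recovered by integrating `u⁻²` against the weighted one. In `ℝ≥0` the inverse of
  -- zero is zero, so on the `ρ` side exactly the part over `{u ≠ 0}` survives.
  have e1 : μ s = ∫⁻ y in s, (((u y ^ 2)⁻¹ : ℝ≥0) : ℝ≥0∞)
      ∂(μ.withDensity (fun y => ((u y ^ 2 : ℝ≥0) : ℝ≥0∞))) := by
    rw [setLIntegral_withDensity_eq_setLIntegral_mul _ (hu.pow_const 2).coe_nnreal_ennreal hv hs,
      ← setLIntegral_one]
    refine lintegral_congr_ae (ae_restrict_of_ae ?_)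
    filter_upwards [hμ] with y hy
    exact (key _ hy).symm
  rw [e1, h, setLIntegral_map hs hv hπ,
    setLIntegral_withDensity_eq_setLIntegral_mul (g := fun x => (((u (π x) ^ 2)⁻¹ : ℝ≥0) : ℝ≥0∞))
    (f := fun x => ((u (π x) ^ 2 : ℝ≥0) : ℝ≥0∞)) _ (hu2.comp hπ) (hv.comp hπ) (hπ hs),
    Measure.map_apply hπ hs, Measure.restrict_apply (hπ hs), ← setLIntegral_one,
    ← lintegral_indicator ((hπ hs).inter hE), ← lintegral_indicator (hπ hs)]
  refine lintegral_congr fun x => ?_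
  by_cases h1 : x ∈ π ⁻¹' s
  · by_cases h2 : u (π x) = 0
    · rw [indicator_of_notMem (fun h => h.2 h2), indicator_of_mem h1]
      simp [h2]
    · rw [indicator_of_mem (show x ∈ π ⁻¹' s ∩ {x | u (π x) ≠ 0} from ⟨h1, h2⟩),
        indicator_of_mem h1]
      exact (key _ h2).symm
  · rw [indicator_of_notMem (fun h => h1 h.1), indicator_of_notMem h1]

/-- If the part of `P` over `{u ≠ 0}` projects to a measure dominated by `C μ`, then integrals
of functions supported over `{u ≠ 0} ²` are dominated by integrals for `μ × μ`. -/
lemma lintegral_prod_comp_le {P : Measure X} [SFinite P] {π : X → K} (hπ : Measurable π)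
    {u : K → ℝ≥0} (hu : Measurable u) {μ : Measure K} [SFinite μ] {C : ℝ≥0}
    (hP : (P.restrict {x | u (π x) ≠ 0}).map π ≤ C • μ) {H : K × K → ℝ≥0∞} (hH : Measurable H)
    (h0 : ∀ y z, u y = 0 ∨ u z = 0 → H (y, z) = 0) :
    ∫⁻ z, H (π z.1, π z.2) ∂(P.prod P) ≤ C * C * ∫⁻ z, H z ∂(μ.prod μ) := by
  have hE : MeasurableSet {x | u (π x) ≠ 0} := (hu.comp hπ) (measurableSet_singleton 0).compl
  have e1 : ∫⁻ z, H (π z.1, π z.2) ∂(P.prod P) =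
      ∫⁻ z in {x | u (π x) ≠ 0} ×ˢ {x | u (π x) ≠ 0}, H (π z.1, π z.2) ∂(P.prod P) := by
    rw [← lintegral_indicator (hE.prod hE)]
    refine lintegral_congr fun z => ?_
    by_cases hz : z ∈ {x | u (π x) ≠ 0} ×ˢ {x | u (π x) ≠ 0}
    · rw [indicator_of_mem hz]
    · rw [indicator_of_notMem hz]
      refine h0 _ _ ?_
      by_contra hcon
      exact hz ⟨fun h => hcon (Or.inl h), fun h => hcon (Or.inr h)⟩
  have e2 : ∫⁻ z, H (π z.1, π z.2)
      ∂((P.restrict {x | u (π x) ≠ 0}).prod (P.restrict {x | u (π x) ≠ 0})) =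
      ∫⁻ z, H z ∂(((P.restrict {x | u (π x) ≠ 0}).map π).prod
        ((P.restrict {x | u (π x) ≠ 0}).map π)) := by
    rw [Measure.map_prod_map _ _ hπ hπ, lintegral_map hH (hπ.prodMap hπ)]
    rfl
  rw [e1, ← Measure.prod_restrict, e2]
  calc _ ≤ ∫⁻ z, H z ∂((C • μ).prod (C • μ)) :=
        lintegral_mono' (Measure.prod_mono hP hP) le_rfl
    _ = _ := by
      rw [Measure.prod_smul_left, Measure.prod_smul_right, lintegral_smul_measure,
        lintegral_smul_measure, ENNReal.smul_def, ENNReal.smul_def, smul_eq_mul, smul_eq_mul,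
        mul_assoc]

lemma integrable_comp_prod {P : Measure X} [SFinite P] {π : X → K} (hπ : Measurable π)
    {u : K → ℝ≥0} (hu : Measurable u) {μ : Measure K} [SFinite μ] {C : ℝ≥0}
    (hP : (P.restrict {x | u (π x) ≠ 0}).map π ≤ C • μ) {V : K × K → ℝ} (hV : Measurable V)
    (hVi : Integrable V (μ.prod μ)) (h0 : ∀ y z, u y = 0 ∨ u z = 0 → V (y, z) = 0) :
    Integrable (fun z : X × X => V (π z.1, π z.2)) (P.prod P) := by
  refine ⟨(hV.comp ((hπ.comp measurable_fst).prodMk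
    (hπ.comp measurable_snd))).aestronglyMeasurable, ?_⟩
  rw [hasFiniteIntegral_iff_enorm]
  refine (lintegral_prod_comp_le hπ hu hP hV.enorm
    (fun y z hyz => by rw [h0 y z hyz, enorm_zero])).trans_lt ?_
  exact ENNReal.mul_lt_top (by finiteness) hVi.hasFiniteIntegral

lemma map_restrict_withDensity_le {ρ : Measure X} {μ : Measure K} {π : X → K} (hπ : Measurable π)
    (hρ : ρ.map π = μ) {w : X → ℝ≥0} {C : ℝ≥0} (hC : ∀ x, w x ≤ C) (E : Set X) :
    ((ρ.withDensity fun x => (w x : ℝ≥0∞)).restrict E).map π ≤ C • μ := by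
  have h1 : ρ.withDensity (fun x => (w x : ℝ≥0∞)) ≤ C • ρ := by
    refine (withDensity_mono (ae_of_all _ fun x => ENNReal.coe_le_coe.2 (hC x))).trans_eq ?_
    exact withDensity_const _
  rw [← hρ, ← Measure.map_smul]
  exact Measure.map_mono (Measure.restrict_le_self.trans h1) hπ

/-- Over `{u ≠ 0}` the weight `w` is positive, so `Q` is there the measure `w⁻¹ Q` multiplied by
`w`, and `w` is at most `C`. This gives the limit the domination that the approximating couplings
enjoy. -/
lemma map_restrict_le_of_divMeasure {Q : Measure X} {μ : Measure K} {π : X → K}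
    (hπ : Measurable π) {w : X → ℝ≥0} (hw : Measurable w) {u : K → ℝ≥0} (hu : Measurable u)
    (huw : ∀ x, u (π x) ≤ w x) {C : ℝ≥0} (hC : ∀ x, w x ≤ C)
    (h : ((divMeasure Q w).restrict {x | u (π x) ≠ 0}).map π = μ) :
    (Q.restrict {x | u (π x) ≠ 0}).map π ≤ C • μ := by
  have hE : MeasurableSet {x | u (π x) ≠ 0} := (hu.comp hπ) (measurableSet_singleton 0).compl
  have h1 : Q.restrict {x | u (π x) ≠ 0} =
      ((divMeasure Q w).restrict {x | u (π x) ≠ 0}).withDensity fun x => (w x : ℝ≥0∞) := by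
    rw [← restrict_withDensity hE, divMeasure,
      ← withDensity_mul _ (f := fun x => (((w x)⁻¹ : ℝ≥0) : ℝ≥0∞)) hw.inv.coe_nnreal_ennreal
        hw.coe_nnreal_ennreal,
      restrict_withDensity hE]
    conv_lhs => rw [← withDensity_one (μ := Q.restrict {x | u (π x) ≠ 0})]
    refine withDensity_congr_ae ?_
    filter_upwards [ae_restrict_mem hE] with x hx
    have hx' : w x ≠ 0 := fun h0 => hx (le_antisymm (h0 ▸ huw x) zero_le)
    rw [Pi.one_apply, Pi.mul_apply, ← ENNReal.coe_mul, inv_mul_cancel₀ hx', ENNReal.coe_one]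
  rw [h1, ← Measure.restrict_univ (μ := Measure.withDensity _ _)]
  exact map_restrict_withDensity_le hπ h hC univ

/-- At a zero of `w` the quotient is squeezed by `v² / w ≤ w`. The plain ratio `v / w` may be
discontinuous there, which is why weights enter squared. -/
lemma continuous_sq_div {X : Type*} [TopologicalSpace X] {v w : X → ℝ≥0} (hv : Continuous v) (hw : Continuous w)
    (hvw : ∀ x, v x ≤ w x) : Continuous fun x => v x ^ 2 / w x := by
  refine continuous_iff_continuousAt.2 fun x => ?_
  by_cases h0 : w x = 0
  · have hle : ∀ y, v y ^ 2 / w y ≤ w y := fun y => by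
      refine div_le_of_le_mul₀ zero_le zero_le ?_
      rw [sq]
      exact mul_le_mul (hvw y) (hvw y) zero_le zero_le
    have h1 : Tendsto w (𝓝 x) (𝓝 0) := h0 ▸ hw.tendsto x
    have h2 : v x ^ 2 / w x = 0 := by rw [h0, div_zero]
    rw [ContinuousAt, h2]
    exact tendsto_of_tendsto_of_tendsto_of_le_of_le tendsto_const_nhds h1 (fun _ => zero_le) hle
  · exact (hv.pow 2).continuousAt.div hw.continuousAt h0

/-- Marginals of limits of weighted couplings. -/
lemma map_restrict_divMeasure_of_tendsto [TopologicalSpace X] [CompactSpace X]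
    [T2Space X] [BorelSpace X] [TopologicalSpace K] [MetrizableSpace K] [BorelSpace K]
    {ι : Type*} {l : Filter ι} [l.NeBot]
    {ρ : ι → Measure X} {w : X → ℝ≥0} (hw : Continuous w) {P : ι → ProbabilityMeasure X}
    (hP : ∀ n, (P n : Measure X) = (ρ n).withDensity fun x => (w x : ℝ≥0∞))
    {Q : ProbabilityMeasure X} (hQ : Tendsto P l (𝓝 Q)) {π : X → K} (hπ : Continuous π)
    {u : K → ℝ≥0} (hu : Continuous u) (huw : ∀ x, u (π x) ≤ w x) {μ : Measure K}
    (hρ : ∀ n, (ρ n).map π = μ) (hμ : ∀ᵐ y ∂μ, u y ≠ 0) :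
    ((divMeasure (Q : Measure X) w).restrict {x | u (π x) ≠ 0}).map π = μ := by
  refine map_restrict_eq_of_withDensity_eq hπ.measurable hu.measurable hμ ?_
  have hc : Continuous fun x => u (π x) ^ 2 / w x := continuous_sq_div (hu.comp hπ) hw huw
  have hu2 : Measurable fun y => ((u y ^ 2 : ℝ≥0) : ℝ≥0∞) :=
    (hu.measurable.pow_const 2).coe_nnreal_ennreal
  -- The test function `(f ∘ π) (u ∘ π)² / w` is continuous. Against `P n = w ρ n` the weight
  -- cancels and the marginal gives the same value for every `n`, which must then be the value at
  -- the limit.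
  have hfin : ∀ f : K →ᵇ ℝ≥0,
      ∫⁻ y, f y ∂(μ.withDensity (fun y => ((u y ^ 2 : ℝ≥0) : ℝ≥0∞))) =
      ∫⁻ x, ((f (π x) * (u (π x) ^ 2 / w x) : ℝ≥0) : ℝ≥0∞) ∂(Q : Measure X) := by
    intro f
    have hfm : Measurable fun y => (f y : ℝ≥0∞) := f.continuous.measurable.coe_nnreal_ennreal
    let h : X →ᵇ ℝ≥0 := BoundedContinuousFunction.mkOfCompact
      ⟨fun x => f (π x) * (u (π x) ^ 2 / w x), (f.continuous.comp hπ).mul hc⟩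
    have hm : Measurable fun x => ((f (π x) * (u (π x) ^ 2 / w x) : ℝ≥0) : ℝ≥0∞) :=
      h.continuous.measurable.coe_nnreal_ennreal
    have h1 := (ProbabilityMeasure.tendsto_iff_forall_lintegral_tendsto.1 hQ) h
    have h2 : ∀ n, ∫⁻ x, ((f (π x) * (u (π x) ^ 2 / w x) : ℝ≥0) : ℝ≥0∞) ∂(P n : Measure X) =
        ∫⁻ y, f y ∂(μ.withDensity (fun y => ((u y ^ 2 : ℝ≥0) : ℝ≥0∞))) := by
      intro n
      rw [hP n, lintegral_withDensity_eq_lintegral_mul _ hw.measurable.coe_nnreal_ennreal hm,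
        lintegral_withDensity_eq_lintegral_mul _ hu2 hfm, ← hρ n,
        lintegral_map (hu2.mul hfm) hπ.measurable]
      refine lintegral_congr fun x => ?_
      simp only [Pi.mul_apply]
      rw [← ENNReal.coe_mul, ← ENNReal.coe_mul]
      congr 1
      by_cases h0 : w x = 0
      · have : u (π x) = 0 := le_antisymm (h0 ▸ huw x) zero_le
        simp [h0, this]
      · field_simp
    have h3 : (fun n => ∫⁻ x, h x ∂(P n : Measure X)) = fun _ => _ := funext h2
    rw [h3] at h1
    exact tendsto_nhds_unique tendsto_const_nhds h1
  have hF : IsFiniteMeasure (μ.withDensity (fun y => ((u y ^ 2 : ℝ≥0) : ℝ≥0∞))) := by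
    constructor
    have h1 := hfin 1
    let h : X →ᵇ ℝ≥0 := BoundedContinuousFunction.mkOfCompact
      ⟨fun x => (1 : K →ᵇ ℝ≥0) (π x) * (u (π x) ^ 2 / w x),
        ((1 : K →ᵇ ℝ≥0).continuous.comp hπ).mul hc⟩
    have h2 : (∫⁻ x, (((1 : K →ᵇ ℝ≥0) (π x) * (u (π x) ^ 2 / w x) : ℝ≥0) : ℝ≥0∞)
        ∂(Q : Measure X)) < ∞ := h.lintegral_lt_top_of_nnreal (Q : Measure X)
    rw [← h1] at h2
    simpa using h2
  refine ext_of_forall_lintegral_eq_of_IsFiniteMeasure fun f => ?_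
  have hfm : Measurable fun y => (f y : ℝ≥0∞) := f.continuous.measurable.coe_nnreal_ennreal
  have hfπ : Measurable fun x => (f (π x) : ℝ≥0∞) := hfm.comp hπ.measurable
  have huπ : Measurable fun x => ((u (π x) ^ 2 : ℝ≥0) : ℝ≥0∞) := hu2.comp hπ.measurable
  rw [hfin f, lintegral_map hfm hπ.measurable, lintegral_withDensity_eq_lintegral_mul _ huπ hfπ,
    lintegral_divMeasure _ hw.measurable (huπ.mul hfπ)]
  refine lintegral_congr fun x => ?_
  simp only [Pi.mul_apply]
  rw [← ENNReal.coe_mul, ← ENNReal.coe_mul]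
  congr 1
  rw [div_eq_mul_inv]
  ring

variable [TopologicalSpace X] [CompactSpace X] [MetrizableSpace X] [SecondCountableTopology X]
  [BorelSpace X] [TopologicalSpace K] [CompactSpace K] [MetrizableSpace K]
  [SecondCountableTopology K] [BorelSpace K]

/-- Integrable functions vanishing where `u ⊗ u` does are approximated by multiples of `u ⊗ u` with
continuous functions. -/
lemma exists_continuous_approx {u : K → ℝ≥0} (hu : Continuous u) {μ : Measure K} [SigmaFinite μ]
    (hfin : ∫⁻ y, u y ∂μ ≠ ∞) {V : K × K → ℝ} (hV : Measurable V)
    (hVi : Integrable V (μ.prod μ)) (h0 : ∀ y z, u y = 0 ∨ u z = 0 → V (y, z) = 0)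
    {ε : ℝ≥0∞} (hε : ε ≠ 0) :
    ∃ k : K × K → ℝ, Continuous k ∧ (∀ y z, u y = 0 ∨ u z = 0 → k (y, z) = 0) ∧
      ∫⁻ z, ‖V z - k z‖ₑ ∂(μ.prod μ) ≤ ε := by
  -- Dividing by `u ⊗ u` transfers the problem to the square of the finite measure `u μ`, where
  -- bounded continuous functions are dense in `L¹`.
  have hF : IsFiniteMeasure (μ.withDensity fun y => (u y : ℝ≥0∞)) :=
    isFiniteMeasure_withDensity hfin
  have hum : Measurable fun y => (u y : ℝ≥0∞) := hu.measurable.coe_nnreal_ennreal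
  set m := μ.withDensity fun y => (u y : ℝ≥0∞)
  have hm : ∀ f : K × K → ℝ, Measurable f → ∫⁻ z, ‖f z‖ₑ ∂(m.prod m) =
      ∫⁻ z, ‖((u z.1 : ℝ) * u z.2) * f z‖ₑ ∂(μ.prod μ) := by
    intro f hf
    rw [prod_withDensity hum hum, lintegral_withDensity_eq_lintegral_mul _ _ hf.enorm]
    · refine lintegral_congr fun z => ?_
      simp [enorm_mul]
    · exact (hum.comp measurable_fst).mul (hum.comp measurable_snd)
  have hum1 : Measurable fun z : K × K => (u z.1 : ℝ) :=
    (hu.measurable.comp measurable_fst).coe_nnreal_real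
  have hum2 : Measurable fun z : K × K => (u z.2 : ℝ) :=
    (hu.measurable.comp measurable_snd).coe_nnreal_real
  let V' : K × K → ℝ := fun z => V z / (u z.1 * u z.2)
  have hV' : Measurable V' := hV.div (hum1.mul hum2)
  have hVV : ∀ z, ((u z.1 : ℝ) * u z.2) * V' z = V z := by
    intro z
    by_cases hz : (u z.1 : ℝ) * u z.2 = 0
    · rw [hz, zero_mul]
      refine (h0 z.1 z.2 ?_).symm
      simpa using hz
    · exact mul_div_cancel₀ _ hz
  have hVi' : Integrable V' (m.prod m) := by
    refine ⟨hV'.aestronglyMeasurable, ?_⟩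
    rw [hasFiniteIntegral_iff_enorm, hm V' hV']
    simp_rw [hVV]
    exact hVi.hasFiniteIntegral
  obtain ⟨g, hg, -⟩ := hVi'.exists_boundedContinuous_lintegral_sub_le hε
  refine ⟨fun z => ((u z.1 : ℝ) * u z.2) * g z, ?_, ?_, ?_⟩
  · exact ((NNReal.continuous_coe.comp (hu.comp continuous_fst)).mul
      (NNReal.continuous_coe.comp (hu.comp continuous_snd))).mul g.continuous
  · rintro y z (h | h) <;> simp [h]
  · refine le_of_eq_of_le ?_ hg
    rw [hm (fun z => V' z - g z) (hV'.sub g.continuous.measurable)]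
    simp_rw [mul_sub, hVV]

/-- Convergence of the integrals of `V(π x, π y) h(x) g(y)`, for integrable `V`. -/
lemma tendsto_integral_comp_prod {ι : Type*} {l : Filter ι}
    {P : ι → ProbabilityMeasure X} {Q : ProbabilityMeasure X} (hQ : Tendsto P l (𝓝 Q))
    {π : X → K} (hπ : Continuous π) {u : K → ℝ≥0} (hu : Continuous u) {μ : Measure K}
    [SigmaFinite μ] (hfin : ∫⁻ y, u y ∂μ ≠ ∞) {C : ℝ≥0}
    (hPC : ∀ n, ((P n : Measure X).restrict {x | u (π x) ≠ 0}).map π ≤ C • μ)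
    (hQC : ((Q : Measure X).restrict {x | u (π x) ≠ 0}).map π ≤ C • μ)
    {V : K × K → ℝ} (hV : Measurable V) (hVi : Integrable V (μ.prod μ))
    (h0 : ∀ y z, u y = 0 ∨ u z = 0 → V (y, z) = 0) (h g : X →ᵇ ℝ) :
    Tendsto (fun n => ∫ z, V (π z.1, π z.2) * (h z.1 * g z.2)
        ∂((P n : Measure X).prod (P n : Measure X))) l
      (𝓝 (∫ z, V (π z.1, π z.2) * (h z.1 * g z.2) ∂((Q : Measure X).prod (Q : Measure X)))) := by
  rw [EMetric.tendsto_nhds]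
  intro ε hε
  have hε3 : ε / 3 ≠ 0 := (ENNReal.div_pos hε.ne' (by norm_num)).ne'
  obtain ⟨δ, hδ, hδε⟩ := ENNReal.exists_nnreal_pos_mul_lt
    (a := C * C * (‖h‖ₑ * ‖g‖ₑ)) (by finiteness) hε3
  obtain ⟨k, hk, hk0, hkV⟩ := exists_continuous_approx hu hfin hV hVi h0
    (ε := δ) (by exact_mod_cast hδ.ne')
  have hππ : Measurable fun z : X × X => (π z.1, π z.2) :=
    (hπ.measurable.comp measurable_fst).prodMk (hπ.measurable.comp measurable_snd)
  have hhg : Continuous fun z : X × X => h z.1 * g z.2 :=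
    (h.continuous.comp continuous_fst).mul (g.continuous.comp continuous_snd)
  have hkc : Continuous fun z : X × X => k (π z.1, π z.2) * (h z.1 * g z.2) :=
    (hk.comp ((hπ.comp continuous_fst).prodMk (hπ.comp continuous_snd))).mul hhg
  let κ : (X × X) →ᵇ ℝ := BoundedContinuousFunction.mkOfCompact ⟨_, hkc⟩
  have bound : ∀ (H : K × K → ℝ) (z : X × X), ‖H (π z.1, π z.2) * (h z.1 * g z.2)‖ₑ ≤
      ‖H (π z.1, π z.2)‖ₑ * (‖h‖ₑ * ‖g‖ₑ) := by
    intro H z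
    rw [enorm_mul, enorm_mul]
    gcongr
    · exact enorm_le_iff_norm_le.2 (h.norm_coe_le_norm _)
    · exact enorm_le_iff_norm_le.2 (g.norm_coe_le_norm _)
  -- Replacing `V` by `k` costs the same for all measures dominated by `C μ` over `{u ≠ 0}`: the
  -- factor `C * C` comes from the two variables.
  have approx : ∀ R : ProbabilityMeasure X,
      ((R : Measure X).restrict {x | u (π x) ≠ 0}).map π ≤ C • μ →
      edist (∫ z, V (π z.1, π z.2) * (h z.1 * g z.2) ∂((R : Measure X).prod (R : Measure X)))
        (∫ z, κ z ∂((R : Measure X).prod (R : Measure X))) < ε / 3 := by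
    intro R hR
    have hVR : Integrable (fun z : X × X => V (π z.1, π z.2) * (h z.1 * g z.2))
        ((R : Measure X).prod (R : Measure X)) := by
      refine ⟨((hV.comp hππ).mul hhg.measurable).aestronglyMeasurable, ?_⟩
      rw [hasFiniteIntegral_iff_enorm]
      refine (lintegral_mono (bound V)).trans_lt ?_
      have hVm : Measurable fun z : X × X => V (π z.1, π z.2) := hV.comp hππ
      rw [lintegral_mul_const _ hVm.enorm]
      refine ENNReal.mul_lt_top ?_ (by finiteness)
      refine (lintegral_prod_comp_le hπ.measurable hu.measurable hR hV.enorm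
        (fun y z hyz => by rw [h0 y z hyz, enorm_zero])).trans_lt ?_
      exact ENNReal.mul_lt_top (by finiteness) hVi.hasFiniteIntegral
    rw [edist_eq_enorm_sub, ← integral_sub hVR (κ.integrable _)]
    refine (enorm_integral_le_lintegral_enorm _).trans_lt (lt_of_le_of_lt ?_ hδε)
    have e : ∀ z : X × X, V (π z.1, π z.2) * (h z.1 * g z.2) - κ z =
        (V - k) (π z.1, π z.2) * (h z.1 * g z.2) := fun z => by
      simp only [κ, BoundedContinuousFunction.mkOfCompact_apply, ContinuousMap.coe_mk,
        Pi.sub_apply]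
      ring
    simp_rw [e]
    refine (lintegral_mono (bound (V - k))).trans ?_
    have hVk : Measurable (V - k) := hV.sub hk.measurable
    have hVm : Measurable fun z : X × X => (V - k) (π z.1, π z.2) := hVk.comp hππ
    rw [lintegral_mul_const _ hVm.enorm]
    calc _ ≤ C * C * (∫⁻ z, ‖(V - k) z‖ₑ ∂(μ.prod μ)) * (‖h‖ₑ * ‖g‖ₑ) := by
          gcongr
          exact lintegral_prod_comp_le hπ.measurable hu.measurable hR hVk.enorm
            (fun y z hyz => by simp [h0 y z hyz, hk0 y z hyz])
      _ ≤ C * C * δ * (‖h‖ₑ * ‖g‖ₑ) := by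
          gcongr
          exact hkV
      _ = δ * (C * C * (‖h‖ₑ * ‖g‖ₑ)) := by ring
  have hprod : Tendsto (fun n => (P n).prod (P n)) l (𝓝 (Q.prod Q)) :=
    (ProbabilityMeasure.continuous_prod.tendsto (Q, Q)).comp (hQ.prodMk_nhds hQ)
  have hκ := (ProbabilityMeasure.tendsto_iff_forall_integral_tendsto.1 hprod) κ
  filter_upwards [EMetric.tendsto_nhds.1 hκ (ε / 3) (pos_iff_ne_zero.2 hε3)] with n hn
  calc _ ≤ _ := edist_triangle4 _ _ _ _
    _ < ε / 3 + ε / 3 + ε / 3 := by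
      refine ENNReal.add_lt_add (ENNReal.add_lt_add (approx (P n) (hPC n)) hn) ?_
      rw [edist_comm]
      exact approx Q hQC
    _ = ε := ENNReal.add_thirds ε

/-- An integrable function on a product is determined by its integrals against products of
bounded continuous functions. -/
lemma ae_eq_zero_of_forall_integral_mul_boundedContinuous {X : Type*} [MeasurableSpace X]
    [TopologicalSpace X] [MetrizableSpace X] [SecondCountableTopology X] [BorelSpace X] {P : Measure X} [IsFiniteMeasure P]
    {F : X × X → ℝ} (hF : Integrable F (P.prod P))
    (h : ∀ f g : X →ᵇ ℝ, ∫ z, F z * (f z.1 * g z.2) ∂(P.prod P) = 0) : F =ᵐ[P.prod P] 0 := by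
  have hfin1 : IsFiniteMeasure ((P.prod P).withDensity fun z => ENNReal.ofReal (F z)) :=
    isFiniteMeasure_withDensity_ofReal hF.2
  have hfin2 : IsFiniteMeasure ((P.prod P).withDensity fun z => ENNReal.ofReal (-F z)) :=
    isFiniteMeasure_withDensity_ofReal hF.neg.2
  -- The positive and negative parts of `F` are densities of two finite measures that agree on
  -- products of test functions, hence coincide.
  have key : ((P.prod P).withDensity fun z => ENNReal.ofReal (F z)) =
      (P.prod P).withDensity fun z => ENNReal.ofReal (-F z) := by
    refine Measure.ext_of_integral_mul_boundedContinuousFunction fun f g => ?_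
    have hfg : Continuous fun z : X × X => f z.1 * g z.2 :=
      (f.continuous.comp continuous_fst).mul (g.continuous.comp continuous_snd)
    have hb : ∀ z : X × X, ‖f z.1 * g z.2‖ ≤ ‖f‖ * ‖g‖ := fun z => by
      rw [norm_mul]
      exact mul_le_mul (f.norm_coe_le_norm _) (g.norm_coe_le_norm _) (norm_nonneg _)
        (norm_nonneg _)
    have hF' : AEMeasurable (fun z => -F z) (P.prod P) := hF.1.aemeasurable.neg
    rw [integral_withDensity_eq_integral_toReal_smul₀ hF.1.aemeasurable.ennreal_ofReal
      (ae_of_all _ fun _ => ENNReal.ofReal_lt_top),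
      integral_withDensity_eq_integral_toReal_smul₀ hF'.ennreal_ofReal
      (ae_of_all _ fun _ => ENNReal.ofReal_lt_top), ← sub_eq_zero, ← integral_sub]
    · rw [← h f g]
      refine integral_congr_ae (ae_of_all _ fun z => ?_)
      simp only [smul_eq_mul, ENNReal.toReal_ofReal', ← sub_mul]
      rw [max_zero_sub_max_neg_zero_eq_self]
    · exact (hF.pos_part).mul_bdd (c := ‖f‖ * ‖g‖) hfg.aestronglyMeasurable (ae_of_all _ hb)
    · exact (hF.neg_part).mul_bdd (c := ‖f‖ * ‖g‖) hfg.aestronglyMeasurable (ae_of_all _ hb)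
  have h1 := (withDensity_eq_iff hF.1.aemeasurable.ennreal_ofReal
    hF.1.aemeasurable.neg.ennreal_ofReal ?_).1 key
  · filter_upwards [h1] with z hz
    simp only [Pi.zero_apply, Pi.neg_apply] at hz ⊢
    rcases le_total (F z) 0 with hz0 | hz0
    · rw [ENNReal.ofReal_of_nonpos hz0, eq_comm, ENNReal.ofReal_eq_zero] at hz
      linarith
    · rw [ENNReal.ofReal_of_nonpos (neg_nonpos.2 hz0), ENNReal.ofReal_eq_zero] at hz
      linarith
  · exact hF.lintegral_lt_top.ne

/-- A sequence of couplings `ρ n` for which `V₁(x₁, y₁) - V₂(x₂, y₂)` tends weakly to zero has a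
limit for which this function vanishes. The limit is in general only a partial coupling, as mass
may escape to `{u₁ = 0}` or `{u₂ = 0}`. -/
theorem exists_limit_coupling {K₁ K₂ : Type*}
    [MeasurableSpace K₁] [TopologicalSpace K₁] [CompactSpace K₁] [MetrizableSpace K₁]
    [SecondCountableTopology K₁] [BorelSpace K₁]
    [MeasurableSpace K₂] [TopologicalSpace K₂] [CompactSpace K₂] [MetrizableSpace K₂]
    [SecondCountableTopology K₂] [BorelSpace K₂]
    {μ₁ : Measure K₁} {μ₂ : Measure K₂} [SigmaFinite μ₁] [SigmaFinite μ₂]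
    {u₁ : K₁ → ℝ≥0} {u₂ : K₂ → ℝ≥0} (hu₁ : Continuous u₁) (hu₂ : Continuous u₂)
    (hμ₁ : ∀ᵐ y ∂μ₁, u₁ y ≠ 0) (hμ₂ : ∀ᵐ y ∂μ₂, u₂ y ≠ 0)
    (hsum : ∫⁻ y, u₁ y ∂μ₁ + ∫⁻ y, u₂ y ∂μ₂ = 1)
    {V₁ : K₁ × K₁ → ℝ} {V₂ : K₂ × K₂ → ℝ} (hV₁ : Measurable V₁) (hV₂ : Measurable V₂)
    (hVi₁ : Integrable V₁ (μ₁.prod μ₁)) (hVi₂ : Integrable V₂ (μ₂.prod μ₂))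
    (h0₁ : ∀ y z, u₁ y = 0 ∨ u₁ z = 0 → V₁ (y, z) = 0)
    (h0₂ : ∀ y z, u₂ y = 0 ∨ u₂ z = 0 → V₂ (y, z) = 0)
    {ρ : ℕ → Measure (K₁ × K₂)} (hρ₁ : ∀ n, (ρ n).map Prod.fst = μ₁)
    (hρ₂ : ∀ n, (ρ n).map Prod.snd = μ₂)
    (hlim : ∀ h g : (K₁ × K₂) →ᵇ ℝ, Tendsto (fun n =>
      ∫ z, (V₁ (z.1.1, z.2.1) - V₂ (z.1.2, z.2.2)) * (h z.1 * g z.2)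
        ∂(((ρ n).withDensity fun x => ((u₁ x.1 + u₂ x.2 : ℝ≥0) : ℝ≥0∞)).prod
          ((ρ n).withDensity fun x => ((u₁ x.1 + u₂ x.2 : ℝ≥0) : ℝ≥0∞)))) atTop (𝓝 0)) :
    ∃ ρ' : Measure (K₁ × K₂), SigmaFinite ρ' ∧
      (ρ'.restrict {x | u₁ x.1 ≠ 0}).map Prod.fst = μ₁ ∧
      (ρ'.restrict {x | u₂ x.2 ≠ 0}).map Prod.snd = μ₂ ∧
      ∀ᵐ z ∂(ρ'.prod ρ'), V₁ (z.1.1, z.2.1) = V₂ (z.1.2, z.2.2) := by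
  let w : K₁ × K₂ → ℝ≥0 := fun x => u₁ x.1 + u₂ x.2
  have hw : Continuous w := (hu₁.comp continuous_fst).add (hu₂.comp continuous_snd)
  have hwm : Measurable fun x => (w x : ℝ≥0∞) := hw.measurable.coe_nnreal_ennreal
  -- The integral of `w` splits into integrals over the two marginals, which do not depend on `n`.
  have hmass : ∀ n, ((ρ n).withDensity fun x => (w x : ℝ≥0∞)) univ = 1 := by
    intro n
    have m₁ : Measurable fun y => (u₁ y : ℝ≥0∞) := hu₁.measurable.coe_nnreal_ennreal
    have m₂ : Measurable fun y => (u₂ y : ℝ≥0∞) := hu₂.measurable.coe_nnreal_ennreal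
    rw [withDensity_apply _ MeasurableSet.univ, Measure.restrict_univ, ← hsum, ← hρ₁ n, ← hρ₂ n,
      lintegral_map m₁ measurable_fst, lintegral_map m₂ measurable_snd,
      ← lintegral_add_left (f := fun x : K₁ × K₂ => (u₁ x.1 : ℝ≥0∞)) (m₁.comp measurable_fst)]
    exact lintegral_congr fun x => ENNReal.coe_add _ _
  let P : ℕ → ProbabilityMeasure (K₁ × K₂) := fun n =>
    ⟨(ρ n).withDensity fun x => (w x : ℝ≥0∞), ⟨hmass n⟩⟩
  have hP : ∀ n, (P n : Measure (K₁ × K₂)) = (ρ n).withDensity fun x => (w x : ℝ≥0∞) :=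
    fun n => rfl
  obtain ⟨Q, -, hQ⟩ := isCompact_univ.ultrafilter_le_nhds ((hyperfilter ℕ).map P)
    (by simp)
  have hQ : Tendsto P (hyperfilter ℕ) (𝓝 Q) := hQ
  have huw₁ : ∀ x : K₁ × K₂, u₁ x.1 ≤ w x := fun x => le_self_add
  have huw₂ : ∀ x : K₁ × K₂, u₂ x.2 ≤ w x := fun x => le_add_self
  have marg₁ := map_restrict_divMeasure_of_tendsto hw hP hQ continuous_fst hu₁ huw₁ hρ₁ hμ₁
  have marg₂ := map_restrict_divMeasure_of_tendsto hw hP hQ continuous_snd hu₂ huw₂ hρ₂ hμ₂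
  obtain ⟨C, hC⟩ : ∃ C : ℝ≥0, ∀ x, w x ≤ C := by
    obtain ⟨C, hC⟩ := (isCompact_range hw).bddAbove
    exact ⟨C, fun x => hC (mem_range_self x)⟩
  have hPC₁ := fun n => map_restrict_withDensity_le (ρ := ρ n) (w := w) measurable_fst (hρ₁ n) hC
    {x | u₁ x.1 ≠ 0}
  have hPC₂ := fun n => map_restrict_withDensity_le (ρ := ρ n) (w := w) measurable_snd (hρ₂ n) hC
    {x | u₂ x.2 ≠ 0}
  have hQC₁ := map_restrict_le_of_divMeasure measurable_fst hw.measurable hu₁.measurable huw₁ hC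
    marg₁
  have hQC₂ := map_restrict_le_of_divMeasure measurable_snd hw.measurable hu₂.measurable huw₂ hC
    marg₂
  have hfin₁ : ∫⁻ y, u₁ y ∂μ₁ ≠ ∞ := ne_top_of_le_ne_top ENNReal.one_ne_top
    (hsum ▸ le_self_add)
  have hfin₂ : ∫⁻ y, u₂ y ∂μ₂ ≠ ∞ := ne_top_of_le_ne_top ENNReal.one_ne_top
    (hsum ▸ le_add_self)
  have int₁ : ∀ R : ProbabilityMeasure (K₁ × K₂),
      ((R : Measure (K₁ × K₂)).restrict {x | u₁ x.1 ≠ 0}).map Prod.fst ≤ C • μ₁ →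
      Integrable (fun z : (K₁ × K₂) × (K₁ × K₂) => V₁ (z.1.1, z.2.1))
        ((R : Measure (K₁ × K₂)).prod (R : Measure (K₁ × K₂))) := fun R hR =>
    integrable_comp_prod measurable_fst hu₁.measurable hR hV₁ hVi₁ h0₁
  have int₂ : ∀ R : ProbabilityMeasure (K₁ × K₂),
      ((R : Measure (K₁ × K₂)).restrict {x | u₂ x.2 ≠ 0}).map Prod.snd ≤ C • μ₂ →
      Integrable (fun z : (K₁ × K₂) × (K₁ × K₂) => V₂ (z.1.2, z.2.2))
        ((R : Measure (K₁ × K₂)).prod (R : Measure (K₁ × K₂))) := fun R hR =>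
    integrable_comp_prod measurable_snd hu₂.measurable hR hV₂ hVi₂ h0₂
  refine ⟨divMeasure (Q : Measure (K₁ × K₂)) w, ?_, marg₁, marg₂, ?_⟩
  · unfold divMeasure
    infer_instance
  have hF : (fun z : (K₁ × K₂) × (K₁ × K₂) => V₁ (z.1.1, z.2.1) - V₂ (z.1.2, z.2.2))
      =ᵐ[(Q : Measure (K₁ × K₂)).prod (Q : Measure (K₁ × K₂))] 0 := by
    refine ae_eq_zero_of_forall_integral_mul_boundedContinuous
      ((int₁ Q hQC₁).sub (int₂ Q hQC₂)) fun h g => ?_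
    have hsplit : ∀ R : ProbabilityMeasure (K₁ × K₂),
        ((R : Measure (K₁ × K₂)).restrict {x | u₁ x.1 ≠ 0}).map Prod.fst ≤ C • μ₁ →
        ((R : Measure (K₁ × K₂)).restrict {x | u₂ x.2 ≠ 0}).map Prod.snd ≤ C • μ₂ →
        ∫ z, (V₁ (z.1.1, z.2.1) - V₂ (z.1.2, z.2.2)) * (h z.1 * g z.2)
          ∂((R : Measure (K₁ × K₂)).prod (R : Measure (K₁ × K₂))) =
        (∫ z, V₁ (z.1.1, z.2.1) * (h z.1 * g z.2)
          ∂((R : Measure (K₁ × K₂)).prod (R : Measure (K₁ × K₂)))) -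
        ∫ z, V₂ (z.1.2, z.2.2) * (h z.1 * g z.2)
          ∂((R : Measure (K₁ × K₂)).prod (R : Measure (K₁ × K₂))) := by
      intro R hR₁ hR₂
      have hfg : Continuous fun z : (K₁ × K₂) × (K₁ × K₂) => h z.1 * g z.2 :=
        (h.continuous.comp continuous_fst).mul (g.continuous.comp continuous_snd)
      have hb : ∀ z : (K₁ × K₂) × (K₁ × K₂), ‖h z.1 * g z.2‖ ≤ ‖h‖ * ‖g‖ := fun z => by
        rw [norm_mul]
        exact mul_le_mul (h.norm_coe_le_norm _) (g.norm_coe_le_norm _) (norm_nonneg _)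
          (norm_nonneg _)
      rw [← integral_sub ((int₁ R hR₁).mul_bdd (c := ‖h‖ * ‖g‖) hfg.aestronglyMeasurable (ae_of_all _ hb))
        ((int₂ R hR₂).mul_bdd (c := ‖h‖ * ‖g‖) hfg.aestronglyMeasurable (ae_of_all _ hb))]
      exact integral_congr_ae (ae_of_all _ fun z => sub_mul _ _ _)
    -- Each kernel is handled separately because each is dominated through its own marginal; only
    -- the difference of the two limits is known to vanish.
    have T₁ := tendsto_integral_comp_prod hQ continuous_fst hu₁ hfin₁ hPC₁ hQC₁ hV₁ hVi₁ h0₁ h g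
    have T₂ := tendsto_integral_comp_prod hQ continuous_snd hu₂ hfin₂ hPC₂ hQC₂ hV₂ hVi₂ h0₂ h g
    have T := (hlim h g).mono_left Nat.hyperfilter_le_atTop
    rw [hsplit Q hQC₁ hQC₂]
    refine tendsto_nhds_unique (T₁.sub T₂) (T.congr fun n => ?_)
    exact hsplit (P n) (hPC₁ n) (hPC₂ n)
  have hac : divMeasure (Q : Measure (K₁ × K₂)) w ≪ (Q : Measure (K₁ × K₂)) :=
    withDensity_absolutelyContinuous _ _
  have hfinal := (hac.prod hac).ae_le hF
  filter_upwards [hfinal] with z hz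
  exact sub_eq_zero.1 hz

end LimitCoupling

end MeasureTheory

namespace MeasureTheory

open Set Filter Topology TopologicalSpace
open scoped NNReal

/-! ### Testing against products of bounded functions -/

section CutNormBound

variable {X : Type*} [MeasurableSpace X]

/-- The bound is applied to the sets where `f` is non-negative and non-positive, whence the factor
two. A strongly measurable representative makes these sets measurable. -/
lemma integral_norm_le_two_mul {ν : Measure X} {f : X → ℝ} (hf : Integrable f ν) {D : ℝ}
    (hD : ∀ T, MeasurableSet T → |∫ x in T, f x ∂ν| ≤ D) : ∫ x, ‖f x‖ ∂ν ≤ 2 * D := by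
  have hg : Integrable (hf.1.mk f) ν := hf.congr hf.1.ae_eq_mk
  have e : ∫ x, ‖f x‖ ∂ν = ∫ x, ‖hf.1.mk f x‖ ∂ν :=
    integral_congr_ae (hf.1.ae_eq_mk.fun_comp norm)
  have hgD : ∀ T, MeasurableSet T → |∫ x in T, hf.1.mk f x ∂ν| ≤ D := fun T hT => by
    rw [← setIntegral_congr_ae hT (hf.1.ae_eq_mk.mono fun x hx _ => hx)]
    exact hD T hT
  have hm := hf.1.stronglyMeasurable_mk.measurable
  rw [e, integral_norm_eq_pos_sub_neg hg]
  have h1 := hgD _ (measurableSet_le measurable_const hm : MeasurableSet {x | 0 ≤ hf.1.mk f x})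
  have h2 := hgD _ (measurableSet_le hm measurable_const : MeasurableSet {x | hf.1.mk f x ≤ 0})
  have h3 := (abs_le.1 h1).2
  have h4 := (abs_le.1 h2).1
  linarith

lemma abs_integral_mul_le {ν : Measure X} {f h : X → ℝ} (hf : Integrable f ν) {B D : ℝ}
    (hB : ∀ x, |h x| ≤ B) (hB0 : 0 ≤ B)
    (hD : ∀ T, MeasurableSet T → |∫ x in T, f x ∂ν| ≤ D) :
    |∫ x, f x * h x ∂ν| ≤ 2 * B * D := by
  calc |∫ x, f x * h x ∂ν| ≤ ∫ x, B * ‖f x‖ ∂ν := by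
        rw [← Real.norm_eq_abs]
        refine norm_integral_le_of_norm_le (hf.norm.const_mul B) (ae_of_all _ fun x => ?_)
        rw [norm_mul, mul_comm]
        exact mul_le_mul_of_nonneg_right (hB x) (norm_nonneg _)
    _ = B * ∫ x, ‖f x‖ ∂ν := integral_const_mul _ _
    _ ≤ B * (2 * D) := mul_le_mul_of_nonneg_left (integral_norm_le_two_mul hf hD) hB0
    _ = 2 * B * D := by ring

/-- Integrals against products of bounded functions are controlled by the integrals over
rectangles. -/
lemma abs_integral_mul_prod_le {ρ : Measure X} [SFinite ρ] {F : X × X → ℝ}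
    (hF : Integrable F (ρ.prod ρ)) {f g : X → ℝ} (hf : Measurable f) {B D : ℝ}
    (hfB : ∀ x, |f x| ≤ B) (hgB : ∀ x, |g x| ≤ B) (hB0 : 0 ≤ B) (hg : Measurable g)
    (hD : ∀ T, MeasurableSet T → ∀ U, MeasurableSet U → |∫ z in T ×ˢ U, F z ∂(ρ.prod ρ)| ≤ D) :
    |∫ z, F z * (f z.1 * g z.2) ∂(ρ.prod ρ)| ≤ 4 * B ^ 2 * D := by
  have hFf : Integrable (fun z => F z * f z.1) (ρ.prod ρ) :=
    hF.mul_bdd (c := B) (hf.comp measurable_fst).aestronglyMeasurable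
      (ae_of_all _ fun z => hfB z.1)
  have hFfg : Integrable (fun z => F z * f z.1 * g z.2) (ρ.prod ρ) :=
    hFf.mul_bdd (c := B) (hg.comp measurable_snd).aestronglyMeasurable
      (ae_of_all _ fun z => hgB z.2)
  -- Sets are replaced by functions one variable at a time: with `U` fixed, the one-variable bound
  -- applies to the integral of `F (x, ·)` over `U`. Each variable contributes a factor `2 * B`.
  have step1 : ∀ U, MeasurableSet U → |∫ z in univ ×ˢ U, F z * f z.1 ∂(ρ.prod ρ)| ≤ 2 * B * D := by
    intro U hU
    have hFU : Integrable F (ρ.prod (ρ.restrict U)) := by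
      have h : Integrable F ((ρ.prod ρ).restrict (univ ×ˢ U)) := hF.integrableOn
      rwa [← Measure.prod_restrict, Measure.restrict_univ] at h
    have hFfU : Integrable (fun z => F z * f z.1) (ρ.prod (ρ.restrict U)) := by
      have h : Integrable (fun z => F z * f z.1) ((ρ.prod ρ).restrict (univ ×ˢ U)) :=
        hFf.integrableOn
      rwa [← Measure.prod_restrict, Measure.restrict_univ] at h
    rw [← Measure.prod_restrict, Measure.restrict_univ, integral_prod _ hFfU]
    simp_rw [integral_mul_const]
    refine abs_integral_mul_le hFU.integral_prod_left hfB hB0 fun T hT => ?_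
    have := hD T hT U hU
    rwa [setIntegral_prod _ hF.integrableOn] at this
  have e : ∫ z, F z * (f z.1 * g z.2) ∂(ρ.prod ρ) =
      ∫ y, (∫ x, F (x, y) * f x ∂ρ) * g y ∂ρ := by
    rw [← integral_congr_ae (ae_of_all _ fun z => mul_assoc (F z) (f z.1) (g z.2)),
      integral_prod_symm _ hFfg]
    simp_rw [integral_mul_const]
  rw [e]
  calc _ ≤ 2 * B * (2 * B * D) := by
        refine abs_integral_mul_le hFf.integral_prod_right hgB hB0 fun U hU => ?_
        have := step1 U hU
        rw [← Measure.prod_restrict, Measure.restrict_univ, integral_prod_symm] at this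
        · exact this
        · have h : Integrable (fun z => F z * f z.1) ((ρ.prod ρ).restrict (univ ×ˢ U)) :=
            hFf.integrableOn
          rwa [← Measure.prod_restrict, Measure.restrict_univ] at h
    _ = 4 * B ^ 2 * D := by ring

/-- Hölder's inequality for the product of a function with bounded integrable functions. -/
lemma enorm_integral_mul_prod_le {ρ : Measure X} [SFinite ρ] {F : X × X → ℝ} {p q : ℝ}
    (hpq : p.HolderConjugate q) (hF : AEStronglyMeasurable F (ρ.prod ρ)) {f g : X → ℝ}
    (hf : Measurable f) (hg : Measurable g) {B : ℝ≥0}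
    (hfB : ∀ x, ‖f x‖ₑ ≤ B) (hgB : ∀ x, ‖g x‖ₑ ≤ B)
    (hfi : ∫⁻ x, ‖f x‖ₑ ∂ρ ≤ B) (hgi : ∫⁻ x, ‖g x‖ₑ ∂ρ ≤ B) :
    ‖∫ z, F z * (f z.1 * g z.2) ∂(ρ.prod ρ)‖ₑ ≤
      eLpNorm F (ENNReal.ofReal p) (ρ.prod ρ) * (((B : ℝ≥0∞) ^ q) * (B : ℝ≥0∞) ^ q) ^ (1 / q) := by
  have hp0 : 0 < p := hpq.pos
  have hq1 : 1 < q := hpq.symm.lt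
  refine (enorm_integral_le_lintegral_enorm _).trans ?_
  simp_rw [enorm_mul]
  have hfg : Measurable fun z : X × X => ‖f z.1‖ₑ * ‖g z.2‖ₑ :=
    (hf.enorm.comp measurable_fst).mul (hg.enorm.comp measurable_snd)
  refine (ENNReal.lintegral_mul_le_Lp_mul_Lq (ρ.prod ρ) hpq hF.enorm hfg.aemeasurable).trans ?_
  -- Interpolation between the sup bound and the `L¹` bound: `|f|^q ≤ B^(q-1) |f|`.
  have hpow : ∀ f : X → ℝ, (∀ x, ‖f x‖ₑ ≤ B) → ∫⁻ x, ‖f x‖ₑ ∂ρ ≤ B →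
      ∫⁻ x, ‖f x‖ₑ ^ q ∂ρ ≤ (B : ℝ≥0∞) ^ q := by
    intro f hfB hfi
    have hsplit : ∀ a : ℝ≥0∞, a ^ q = a ^ (q - 1) * a := fun a => by
      conv_rhs => rw [← ENNReal.rpow_one a, ← ENNReal.rpow_mul, one_mul]
      rw [← ENNReal.rpow_add_of_nonneg _ _ (by linarith) zero_le_one]
      congr 1; ring
    calc ∫⁻ x, ‖f x‖ₑ ^ q ∂ρ ≤ ∫⁻ x, (B : ℝ≥0∞) ^ (q - 1) * ‖f x‖ₑ ∂ρ := by
          refine lintegral_mono fun x => ?_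
          rw [hsplit]
          exact mul_le_mul' (ENNReal.rpow_le_rpow (hfB x) (by linarith)) le_rfl
      _ = (B : ℝ≥0∞) ^ (q - 1) * ∫⁻ x, ‖f x‖ₑ ∂ρ :=
          lintegral_const_mul' _ _ (ENNReal.rpow_ne_top_of_nonneg (by linarith) ENNReal.coe_ne_top)
      _ ≤ (B : ℝ≥0∞) ^ (q - 1) * B := by gcongr
      _ = (B : ℝ≥0∞) ^ q := (hsplit _).symm
  gcongr
  · rw [eLpNorm_eq_lintegral_rpow_enorm_toReal (ENNReal.ofReal_pos.2 hp0).ne'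
      ENNReal.ofReal_ne_top, ENNReal.toReal_ofReal hp0.le]
  · simp_rw [ENNReal.mul_rpow_of_nonneg _ _ hpq.symm.nonneg]
    rw [lintegral_prod_mul (hf.enorm.pow_const q).aemeasurable
      (hg.enorm.pow_const q).aemeasurable]
    exact mul_le_mul' (hpow f hfB hfi) (hpow g hgB hgi)

end CutNormBound

/-! ### Coding kernels on a compact cube -/

section Standardization

/-- A compact metrizable space that carries a copy of every integrable kernel. -/
abbrev CodeSpace : Type u := ULift.{u} ℕ → unitInterval

/-- The weight on the code space: its first coordinate. -/
noncomputable def CodeSpace.weight (y : CodeSpace.{u}) : ℝ≥0 :=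
  ⟨y ⟨0⟩, (y ⟨0⟩).2.1⟩

lemma CodeSpace.continuous_weight : Continuous CodeSpace.weight.{u} :=
  Continuous.subtype_mk (continuous_subtype_val.comp (continuous_apply _)) _

/-- Code of a natural number in the unit interval. -/
noncomputable def natCode (n : ℕ) : unitInterval :=
  ⟨((n : ℝ) + 1)⁻¹, inv_nonneg.2 (by positivity), inv_le_one_of_one_le₀ (by simp)⟩

/-- Inverse of `natCode`. -/
noncomputable def natDecode (t : unitInterval) : ℕ := ⌊(t : ℝ)⁻¹⌋₊ - 1

lemma natDecode_natCode (n : ℕ) : natDecode (natCode n) = n := by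
  have : ⌊(n : ℝ) + 1⌋₊ = n + 1 := by exact_mod_cast Nat.floor_natCast (R := ℝ) (n + 1)
  rw [natDecode, natCode, inv_inv, this, Nat.add_sub_cancel]

lemma measurable_natDecode : Measurable natDecode :=
  (Measurable.of_discrete (f := fun n : ℕ => n - 1)).comp
    (Nat.measurable_floor.comp measurable_subtype_coe.inv)

/-- An integrable kernel on a σ-finite space is a.e. the pull-back of a kernel on the code space. -/
lemma exists_standardization {S : Type u} [MeasurableSpace S] (μ : Measure S) [SigmaFinite μ]
    {W : S × S → ℝ} (hW : Integrable W (μ.prod μ)) :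
    ∃ (φ : S → CodeSpace.{u}) (V : CodeSpace.{u} × CodeSpace.{u} → ℝ), Measurable φ ∧
      Measurable V ∧ (W =ᵐ[μ.prod μ] fun z => V (φ z.1, φ z.2)) ∧
      (∀ x, (φ x).weight ≠ 0) ∧ ∫⁻ x, (φ x).weight ∂μ ≠ ∞ := by
  obtain ⟨w, hw0, hwm, hwi⟩ := exists_pos_lintegral_lt_of_sigmaFinite μ one_ne_zero
  have hstep : ∀ k : ℕ, ∃ g, IsStep μ g ∧ eLpNorm (W - g) 1 (μ.prod μ) ≤ ((k : ℝ≥0∞) + 1)⁻¹ :=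
    fun k => (memLp_one_iff_integrable.2 hW).exists_isStep_eLpNorm_sub_le ENNReal.one_ne_top
      (ENNReal.inv_ne_zero.2 (by finiteness))
  choose g hg hgW using hstep
  have hgl : Tendsto (fun k => eLpNorm (g k - W) 1 (μ.prod μ)) atTop (𝓝 0) := by
    have h0 : Tendsto (fun k : ℕ => ((k : ℝ≥0∞) + 1)⁻¹) atTop (𝓝 0) := by
      have := (ENNReal.tendsto_inv_nat_nhds_zero).comp (tendsto_add_atTop_nat 1)
      refine this.congr fun k => ?_
      simp
    refine tendsto_of_tendsto_of_tendsto_of_le_of_le tendsto_const_nhds h0 (fun _ => zero_le)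
      fun k => ?_
    rw [eLpNorm_sub_comm]
    exact hgW k
  obtain ⟨ns, -, hns⟩ := (tendstoInMeasure_of_tendsto_eLpNorm one_ne_zero
    (fun k => (hg k).measurable.aestronglyMeasurable) hW.1 hgl).exists_seq_tendsto_ae
  choose a c ha _ hgac using hg
  -- Coordinate `0` is a positive integrable weight truncated to the unit interval; coordinate `k +
  -- 1` encodes the cell of `x` in the partition of the `k`-th step function of the a.e. convergent
  -- subsequence.
  let φ : S → CodeSpace.{u} := fun x i => Nat.rec
    (⟨min (w x) 1, by positivity, min_le_right _ _⟩ : unitInterval)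
    (fun k _ => natCode (a (ns k) x)) i.down
  have hφ : Measurable φ := by
    refine measurable_pi_iff.2 ?_
    rintro ⟨k⟩
    cases k with
    | zero => exact Measurable.subtype_mk (hwm.coe_nnreal_real.min measurable_const)
    | succ k => exact (Measurable.of_discrete (f := natCode)).comp (ha (ns k))
  let G : ℕ → CodeSpace.{u} × CodeSpace.{u} → ℝ := fun k z =>
    c (ns k) (natDecode (z.1 ⟨k + 1⟩), natDecode (z.2 ⟨k + 1⟩))
  have hG : ∀ k, Measurable (G k) := fun k =>
    (Measurable.of_discrete (f := c (ns k))).comp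
      ((measurable_natDecode.comp ((measurable_pi_apply (ULift.up (k + 1))).comp
        measurable_fst)).prodMk (measurable_natDecode.comp
          ((measurable_pi_apply (ULift.up (k + 1))).comp measurable_snd)))
  -- The `limsup` is measurable on the whole cube and equals the limit wherever the decoded step
  -- functions converge.
  refine ⟨φ, fun z => limsup (fun k => G k z) atTop, hφ, Measurable.limsup hG, ?_, fun x => ?_, ?_⟩
  · filter_upwards [hns] with z hz
    refine (Tendsto.limsup_eq (hz.congr fun k => ?_)).symm
    rw [hgac (ns k)]
    simp only [G, φ, natDecode_natCode]
  · intro h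
    have h1 : min (w x : ℝ) 1 = 0 := congrArg NNReal.toReal h
    have h2 : (0 : ℝ) < min (w x : ℝ) 1 := lt_min (by exact_mod_cast hw0 x) one_pos
    exact h2.ne' h1
  · refine ((lintegral_mono fun x => ?_).trans_lt (hwi.trans ENNReal.one_lt_top)).ne
    refine ENNReal.coe_le_coe.2 ?_
    exact (NNReal.coe_le_coe.1 (min_le_left (w x : ℝ) 1) : (φ x).weight ≤ w x)

end Standardization

end MeasureTheory

namespace Graphon

open Set Filter Topology TopologicalSpace
open scoped NNReal

/-! ### Chains of elementary equivalences -/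

section Chains

lemma ElemEquiv.symm {W W' : Graphon.{u}} (h : ElemEquiv W W') : ElemEquiv W' W := by
  rcases h with (h | h) | (h | h)
  · exact Or.inl (Or.inr h)
  · exact Or.inl (Or.inl h)
  · exact Or.inr (Or.inr h)
  · exact Or.inr (Or.inl h)

/-- Elementary equivalences generate an equivalence relation. -/
abbrev Linked : Graphon.{u} → Graphon.{u} → Prop := Relation.ReflTransGen ElemEquiv

lemma Linked.symm {W W' : Graphon.{u}} (h : Linked W W') : Linked W' W := by
  induction h with
  | refl => exact .refl
  | tail _ h ih => exact .head h.symm ih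

lemma elemChain_iff_linked {W W' : Graphon.{u}} : ElemChain W W' ↔ Linked W W' := by
  constructor
  · rintro ⟨N, V, rfl, rfl, h⟩
    induction N with
    | zero => exact .refl
    | succ N ih => exact (ih fun i hi => h i (by omega)).tail (h N (by omega))
  · intro h
    induction h with
    | refl => exact ⟨0, fun _ => W, rfl, rfl, fun i hi => absurd hi (by omega)⟩
    | @tail B C _ hBC ih =>
      obtain ⟨N, V, h0, hN, h⟩ := ih
      refine ⟨N + 1, fun i => if i ≤ N then V i else C, by simp [h0], by simp, fun i hi => ?_⟩
      rcases Nat.lt_succ_iff_lt_or_eq.1 hi with hi | rfl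
      · simpa [hi.le, Nat.succ_le_of_lt hi] using h i hi
      · simpa [hN] using hBC

lemma IsPullback.linked {W W' : Graphon.{u}} (h : IsPullback W W') : Linked W W' :=
  .single (Or.inl (Or.inl h))

lemma IsTrivialExtension.linked {W W' : Graphon.{u}} (h : IsTrivialExtension W' W) :
    Linked W W' :=
  .single (Or.inr (Or.inr h))

end Chains

/-! ### From partial couplings to chains -/

section PartialCoupling

variable (W : Graphon.{u}) {X : Type u} [MeasurableSpace X] {ρ : Measure X} {π : X → W.carrier}
  {E : Set W.carrier}

lemma measurePreserving_subtype (hπ : Measurable π) (hE : MeasurableSet E)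
    (hρ : (ρ.restrict (π ⁻¹' E)).map π = W.μ) :
    MeasurePreserving (fun x : π ⁻¹' E => π x) (ρ.comap Subtype.val) W.μ := by
  refine ⟨hπ.comp measurable_subtype_coe, ?_⟩
  rw [← hρ, ← map_comap_subtype_coe (hπ hE), Measure.map_map hπ measurable_subtype_coe]
  rfl

/-- The measure `ρ` is uncontrolled off `π ⁻¹' E`, but a pair with a point there contributes zero.
-/
lemma integrable_pull [SigmaFinite ρ] (hπ : Measurable π)
    (hρ : (ρ.restrict (π ⁻¹' E)).map π = W.μ)
    (h0 : ∀ x y, x ∉ E ∨ y ∉ E → W.toFun (x, y) = 0) :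
    Integrable (fun z : X × X => W.toFun (π z.1, π z.2)) (ρ.prod ρ) := by
  have mp : MeasurePreserving π (ρ.restrict (π ⁻¹' E)) W.μ := ⟨hπ, hρ⟩
  have h1 := (mp.prod mp).integrable_comp_of_integrable W.integrable
  rw [Measure.prod_restrict] at h1
  refine IntegrableOn.integrable_of_forall_notMem_eq_zero h1 fun z hz => ?_
  refine h0 _ _ ?_
  by_contra hcon
  exact hz ⟨by_contra fun h => hcon (Or.inl h), by_contra fun h => hcon (Or.inr h)⟩

/-- The pull-back of a graphon along a map `π`, as a graphon on the measure `ρ`. -/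
def pull (ρ : Measure X) [SigmaFinite ρ] (π : X → W.carrier)
    (h : Integrable (fun z : X × X => W.toFun (π z.1, π z.2)) (ρ.prod ρ)) : Graphon.{u} where
  carrier := X
  μ := ρ
  toFun z := W.toFun (π z.1, π z.2)
  symm _ _ := W.symm _ _
  integrable := h

/-- If `π` is measure preserving on the preimage of a set `E` off which `W` vanishes, then `W` is
linked to its pull-back along `π`. -/
lemma linked_pull [SigmaFinite ρ] (hπ : Measurable π) (hE : MeasurableSet E)
    (hρ : (ρ.restrict (π ⁻¹' E)).map π = W.μ)
    (h0 : ∀ x y, x ∉ E ∨ y ∉ E → W.toFun (x, y) = 0) :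
    Linked W (W.pull ρ π (W.integrable_pull hπ hρ h0)) := by
  have mp := W.measurePreserving_subtype hπ hE hρ
  have : SigmaFinite (ρ.comap (Subtype.val : π ⁻¹' E → X)) := by
    refine SigmaFinite.of_map _ measurable_subtype_coe.aemeasurable ?_
    rw [map_comap_subtype_coe (hπ hE)]
    infer_instance
  -- The intermediate graphon lives on `π ⁻¹' E`: it is a pull-back of `W`, and the full pull-back
  -- is a trivial extension of it.
  let Z : Graphon.{u} := W.pull (ρ.comap (Subtype.val : π ⁻¹' E → X)) (fun x => π x)
    ((mp.prod mp).integrable_comp_of_integrable W.integrable)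
  have h1 : IsPullback Z W := ⟨fun x : π ⁻¹' E => π x, mp, Filter.EventuallyEq.rfl⟩
  have h2 : IsTrivialExtension (W.pull ρ π (W.integrable_pull hπ hρ h0)) Z := by
    refine ⟨Subtype.val, MeasurableEmbedding.subtype_coe (hπ hE), rfl, fun _ _ => rfl, ?_⟩
    intro x y hxy
    refine h0 _ _ ?_
    have key : ∀ x : X, x ∉ range (Subtype.val : π ⁻¹' E → X) → π x ∉ E := fun x hx h =>
      hx ⟨⟨x, h⟩, rfl⟩
    exact hxy.imp (key x) (key y)
  exact h1.linked.symm.trans h2.linked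

/-- Two graphons that agree almost everywhere under a partial coupling, each of them vanishing off
the coupled part, are linked. -/
lemma linked_of_partialCoupling {W₁ W₂ : Graphon.{u}}
    {ρ : Measure (W₁.carrier × W₂.carrier)} [SigmaFinite ρ] {E₁ : Set W₁.carrier}
    {E₂ : Set W₂.carrier} (hE₁ : MeasurableSet E₁) (hE₂ : MeasurableSet E₂)
    (h₁ : (ρ.restrict (Prod.fst ⁻¹' E₁)).map Prod.fst = W₁.μ)
    (h₂ : (ρ.restrict (Prod.snd ⁻¹' E₂)).map Prod.snd = W₂.μ)
    (h0₁ : ∀ x y, x ∉ E₁ ∨ y ∉ E₁ → W₁.toFun (x, y) = 0)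
    (h0₂ : ∀ x y, x ∉ E₂ ∨ y ∉ E₂ → W₂.toFun (x, y) = 0)
    (hW : ∀ᵐ z ∂(ρ.prod ρ), W₁.toFun (z.1.1, z.2.1) = W₂.toFun (z.1.2, z.2.2)) :
    Linked W₁ W₂ := by
  have l₁ := W₁.linked_pull measurable_fst hE₁ h₁ h0₁
  have l₂ := W₂.linked_pull measurable_snd hE₂ h₂ h0₂
  -- Both pull-backs live on `ρ` and agree a.e., so the identity map links them.
  have l : IsPullback (W₁.pull ρ Prod.fst (W₁.integrable_pull measurable_fst h₁ h0₁))
      (W₂.pull ρ Prod.snd (W₂.integrable_pull measurable_snd h₂ h0₂)) :=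
    ⟨fun x => x, MeasurePreserving.id ρ, hW⟩
  exact (l₁.trans l.linked).trans l₂.symm

end PartialCoupling

/-! ### Replacing a graphon by its code -/

section Code

/-- The measure has density `w⁻¹` with respect to the finite measure `w τ`. An image of a σ-finite
measure need not be σ-finite; keeping the weight as a coordinate of the code guarantees it. -/
lemma sigmaFinite_of_weight {Y : Type*} [MeasurableSpace Y] {τ : Measure Y} {w : Y → ℝ≥0}
    (hw : Measurable w) (h0 : ∀ᵐ y ∂τ, w y ≠ 0) (hi : ∫⁻ y, w y ∂τ ≠ ∞) : SigmaFinite τ := by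
  have hF : IsFiniteMeasure (τ.withDensity fun y => (w y : ℝ≥0∞)) := isFiniteMeasure_withDensity hi
  have h1 : (τ.withDensity fun y => (w y : ℝ≥0∞)).withDensity (fun y => (w y : ℝ≥0∞)⁻¹) = τ :=
    withDensity_inv_same hw.coe_nnreal_ennreal (h0.mono fun y hy => ENNReal.coe_ne_zero.2 hy)
      (ae_of_all _ fun y => ENNReal.coe_ne_top)
  rw [← h1]
  refine SigmaFinite.withDensity_of_ne_top ?_
  refine (withDensity_absolutelyContinuous _ _).ae_le ?_
  filter_upwards [h0] with y hy
  exact ENNReal.inv_ne_top.2 (ENNReal.coe_ne_zero.2 hy)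

/-- Every graphon is a pull-back of a measurable graphon on the code space, with positive
integrable weight. -/
lemma exists_code (W : Graphon.{u}) :
    ∃ (Y : Measure CodeSpace.{u}) (_ : SigmaFinite Y)
      (V : CodeSpace.{u} × CodeSpace.{u} → ℝ) (hs : ∀ x y, V (x, y) = V (y, x))
      (hi : Integrable V (Y.prod Y)), Measurable V ∧
      (∀ y z, y.weight = 0 ∨ z.weight = 0 → V (y, z) = 0) ∧
      (∀ᵐ y ∂Y, y.weight ≠ 0) ∧ ∫⁻ y, y.weight ∂Y ≠ ∞ ∧
      IsPullback W ⟨CodeSpace.{u}, Y, V, hs, hi⟩ := by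
  obtain ⟨φ, V, hφ, hV, hWV, hφ0, hφi⟩ := exists_standardization W.μ W.integrable
  have hwm : Measurable CodeSpace.weight.{u} := CodeSpace.continuous_weight.measurable
  have h0 : ∀ᵐ y ∂(W.μ.map φ), y.weight ≠ 0 := by
    refine (ae_map_iff (p := fun y : CodeSpace.{u} => y.weight ≠ 0) hφ.aemeasurable
      (hwm (measurableSet_singleton 0)).compl).2 ?_
    exact ae_of_all _ hφ0
  have hi : ∫⁻ y, y.weight ∂(W.μ.map φ) ≠ ∞ := by
    rwa [lintegral_map hwm.coe_nnreal_ennreal hφ]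
  have hσ : SigmaFinite (W.μ.map φ) := sigmaFinite_of_weight hwm h0 hi
  have mp : MeasurePreserving φ W.μ (W.μ.map φ) := ⟨hφ, rfl⟩
  let D : Set (CodeSpace.{u} × CodeSpace.{u}) := {y | y.weight ≠ 0} ×ˢ {y | y.weight ≠ 0}
  have hD : MeasurableSet D := (hwm (measurableSet_singleton 0)).compl.prod
    (hwm (measurableSet_singleton 0)).compl
  -- A graphon must be symmetric at every point, and the limit argument needs a kernel that vanishes
  -- wherever a weight does; neither change is visible through `φ`.
  let V' : CodeSpace.{u} × CodeSpace.{u} → ℝ := D.indicator fun z => (V z + V z.swap) / 2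
  have hV' : Measurable V' := ((hV.add (hV.comp measurable_swap)).div_const 2).indicator hD
  have hWV' : W.toFun =ᵐ[W.sqMeasure] fun z => V' (φ z.1, φ z.2) := by
    have hsw : ∀ᵐ z ∂W.sqMeasure, W.toFun z.swap = V (φ z.2, φ z.1) :=
      (Measure.measurePreserving_swap (μ := W.μ) (ν := W.μ)).quasiMeasurePreserving.ae hWV
    filter_upwards [hWV, hsw] with z hz hz'
    have hmem : (φ z.1, φ z.2) ∈ D := ⟨hφ0 _, hφ0 _⟩
    have e : W.toFun z.swap = W.toFun z := W.symm z.2 z.1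
    simp only [V', indicator_of_mem hmem, Prod.swap_prod_mk]
    rw [← hz, ← hz', e]
    ring
  have hVi : Integrable V' ((W.μ.map φ).prod (W.μ.map φ)) := by
    refine ((mp.prod mp).integrable_comp hV'.aestronglyMeasurable).1 ?_
    exact W.integrable.congr hWV'
  refine ⟨W.μ.map φ, hσ, V', fun x y => ?_, hVi, hV', fun y z hyz => ?_, h0, hi, φ, mp, hWV'⟩
  · by_cases h : (x, y) ∈ D
    · have h' : (y, x) ∈ D := ⟨h.2, h.1⟩
      simp only [V', indicator_of_mem h, indicator_of_mem h', Prod.swap_prod_mk, add_comm]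
    · have h' : (y, x) ∉ D := fun h' => h ⟨h'.2, h'.1⟩
      simp only [V', indicator_of_notMem h, indicator_of_notMem h']
  · refine indicator_of_notMem (fun h => ?_) _
    rcases hyz with hy | hz
    · exact h.1 hy
    · exact h.2 hz

end Code

/-! ### Vanishing distance implies a chain -/

section Compactness

variable {W₁ W₂ : Graphon.{u}}

lemma IsCouplingMeasure.mp_fst {S T : Type u} [MeasurableSpace S]
    [MeasurableSpace T] {ρ : Measure (S × T)} {μ₁ : Measure S} {μ₂ : Measure T}
    (h : IsCouplingMeasure ρ μ₁ μ₂) : MeasurePreserving Prod.fst ρ μ₁ :=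
  ⟨measurable_fst, h.map_fst⟩

lemma IsCouplingMeasure.mp_snd {S T : Type u} [MeasurableSpace S]
    [MeasurableSpace T] {ρ : Measure (S × T)} {μ₁ : Measure S} {μ₂ : Measure T}
    (h : IsCouplingMeasure ρ μ₁ μ₂) : MeasurePreserving Prod.snd ρ μ₂ :=
  ⟨measurable_snd, h.map_snd⟩

lemma IsCouplingMeasure.sigmaFinite {S T : Type u} [MeasurableSpace S]
    [MeasurableSpace T] {ρ : Measure (S × T)} {μ₁ : Measure S} {μ₂ : Measure T} [SigmaFinite μ₁]
    (h : IsCouplingMeasure ρ μ₁ μ₂) : SigmaFinite ρ := by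
  refine SigmaFinite.of_map ρ measurable_fst.aemeasurable ?_
  rw [h.map_fst]
  infer_instance

/-- Graphons are linked as soon as there are couplings for which the difference of the pull-backs
tends to zero when tested against products of bounded, uniformly integrable functions. -/
theorem linked_of_tendsto {ρ : ℕ → Measure (W₁.carrier × W₂.carrier)}
    (hρ : ∀ n, IsCouplingMeasure (ρ n) W₁.μ W₂.μ)
    (hlim : ∀ (f g : W₁.carrier × W₂.carrier → ℝ) (B : ℝ≥0), Measurable f → Measurable g →
      (∀ x, ‖f x‖ₑ ≤ B) → (∀ x, ‖g x‖ₑ ≤ B) → (∀ n, ∫⁻ x, ‖f x‖ₑ ∂(ρ n) ≤ B) →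
      (∀ n, ∫⁻ x, ‖g x‖ₑ ∂(ρ n) ≤ B) →
      Tendsto (fun n => ∫ z, pullbackDiff W₁ W₂ z * (f z.1 * g z.2) ∂((ρ n).prod (ρ n)))
        atTop (𝓝 0)) : Linked W₁ W₂ := by
  obtain ⟨Y₁, σ₁, V₁, hs₁, hi₁, hV₁, h0₁, hw₁, hwi₁, φ₁, hφ₁, hWV₁⟩ := W₁.exists_code
  obtain ⟨Y₂, σ₂, V₂, hs₂, hi₂, hV₂, h0₂, hw₂, hwi₂, φ₂, hφ₂, hWV₂⟩ := W₂.exists_code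
  have p₁ : Linked W₁ ⟨CodeSpace.{u}, Y₁, V₁, hs₁, hi₁⟩ := IsPullback.linked ⟨φ₁, hφ₁, hWV₁⟩
  have p₂ : Linked W₂ ⟨CodeSpace.{u}, Y₂, V₂, hs₂, hi₂⟩ := IsPullback.linked ⟨φ₂, hφ₂, hWV₂⟩
  refine (p₁.trans ?_).trans p₂.symm
  change MeasurePreserving φ₁ W₁.μ Y₁ at hφ₁
  change MeasurePreserving φ₂ W₂.μ Y₂ at hφ₂
  have hwc := CodeSpace.continuous_weight.{u}
  have hwm : Measurable CodeSpace.weight.{u} := hwc.measurable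
  obtain ⟨M, hM⟩ : ∃ M : ℝ≥0, ∫⁻ y, y.weight ∂Y₁ + ∫⁻ y, y.weight ∂Y₂ = M :=
    ⟨_, (ENNReal.coe_toNNReal (ENNReal.add_ne_top.2 ⟨hwi₁, hwi₂⟩)).symm⟩
  have hEm : MeasurableSet {y : CodeSpace.{u} | y.weight ≠ 0} :=
    (hwm (measurableSet_singleton 0)).compl
  have hoff₁ : ∀ x y, x ∉ {y : CodeSpace.{u} | y.weight ≠ 0} ∨
      y ∉ {y : CodeSpace.{u} | y.weight ≠ 0} → V₁ (x, y) = 0 := fun x y h =>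
    h0₁ x y (h.imp not_not.1 not_not.1)
  have hoff₂ : ∀ x y, x ∉ {y : CodeSpace.{u} | y.weight ≠ 0} ∨
      y ∉ {y : CodeSpace.{u} | y.weight ≠ 0} → V₂ (x, y) = 0 := fun x y h =>
    h0₂ x y (h.imp not_not.1 not_not.1)
  -- If the total weight is zero, both measures vanish, as the weight is non-zero a.e.; the zero
  -- measure is then a coupling. Otherwise dividing by `M` normalises.
  by_cases hM0 : M = 0
  · rw [hM0, ENNReal.coe_zero, add_eq_zero] at hM
    have z : ∀ Y : Measure CodeSpace.{u}, (∀ᵐ y ∂Y, y.weight ≠ 0) → ∫⁻ y, y.weight ∂Y = 0 →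
        Y = 0 := by
      intro Y h0 h
      rw [lintegral_eq_zero_iff hwm.coe_nnreal_ennreal] at h
      have hfalse : ∀ᵐ y ∂Y, False := by
        filter_upwards [h0, h] with y h1 h2
        exact h1 (ENNReal.coe_eq_zero.1 h2)
      simpa using hfalse
    refine linked_of_partialCoupling (W₁ := ⟨CodeSpace.{u}, Y₁, V₁, hs₁, hi₁⟩)
      (W₂ := ⟨CodeSpace.{u}, Y₂, V₂, hs₂, hi₂⟩) (ρ := 0) hEm hEm ?_ ?_ hoff₁ hoff₂ ?_
    · simpa using (z Y₁ hw₁ hM.1).symm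
    · simpa using (z Y₂ hw₂ hM.2).symm
    · simp
  let v : CodeSpace.{u} → ℝ≥0 := fun y => M⁻¹ * y.weight
  have hv : Continuous v := continuous_const.mul hwc
  have hv0 : ∀ y, v y = 0 ↔ y.weight = 0 := fun y => by simp [v, hM0]
  have hvsum : ∫⁻ y, v y ∂Y₁ + ∫⁻ y, v y ∂Y₂ = 1 := by
    simp only [v, ENNReal.coe_mul]
    rw [lintegral_const_mul _ hwm.coe_nnreal_ennreal, lintegral_const_mul _ hwm.coe_nnreal_ennreal,
      ← mul_add, hM, ← ENNReal.coe_mul, inv_mul_cancel₀ hM0, ENNReal.coe_one]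
  let Φ : W₁.carrier × W₂.carrier → CodeSpace.{u} × CodeSpace.{u} := Prod.map φ₁ φ₂
  have hΦ : Measurable Φ := hφ₁.measurable.prodMap hφ₂.measurable
  let w : CodeSpace.{u} × CodeSpace.{u} → ℝ≥0 := fun x => v x.1 + v x.2
  have hw : Continuous w := (hv.comp continuous_fst).add (hv.comp continuous_snd)
  obtain ⟨C, hC⟩ : ∃ C : ℝ≥0, ∀ x, w x ≤ C := by
    obtain ⟨C, hC⟩ := (isCompact_range hw).bddAbove
    exact ⟨C, fun x => hC (mem_range_self x)⟩
  have hwint : ∀ n, ∫⁻ x, w (Φ x) ∂(ρ n) = 1 := by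
    intro n
    have m : Measurable fun y => (v y : ℝ≥0∞) := hv.measurable.coe_nnreal_ennreal
    have e₁ := ((hφ₁.comp (hρ n).mp_fst).lintegral_comp m)
    have e₂ := ((hφ₂.comp (hρ n).mp_snd).lintegral_comp m)
    rw [← hvsum, ← e₁, ← e₂, ← lintegral_add_left
      (f := fun x : W₁.carrier × W₂.carrier => (v ((φ₁ ∘ Prod.fst) x) : ℝ≥0∞)) (m.comp (hφ₁.comp (hρ n).mp_fst).measurable)]
    exact lintegral_congr fun x => ENNReal.coe_add _ _
  have hmap₁ : ∀ n, ((ρ n).map Φ).map Prod.fst = Y₁ := fun n => by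
    rw [Measure.map_map measurable_fst hΦ]
    exact (hφ₁.comp (hρ n).mp_fst).map_eq
  have hmap₂ : ∀ n, ((ρ n).map Φ).map Prod.snd = Y₂ := fun n => by
    rw [Measure.map_map measurable_snd hΦ]
    exact (hφ₂.comp (hρ n).mp_snd).map_eq
  have hwt₁ : ∀ᵐ y ∂Y₁, v y ≠ 0 := hw₁.mono fun y hy h => hy ((hv0 y).1 h)
  have hwt₂ : ∀ᵐ y ∂Y₂, v y ≠ 0 := hw₂.mono fun y hy h => hy ((hv0 y).1 h)
  obtain ⟨ρ', hσ, m₁, m₂, hae⟩ := exists_limit_coupling hv hv hwt₁ hwt₂ hvsum hV₁ hV₂ hi₁ hi₂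
    (fun y z h => h0₁ y z (h.imp (hv0 y).1 (hv0 z).1))
    (fun y z h => h0₂ y z (h.imp (hv0 y).1 (hv0 z).1)) hmap₁ hmap₂ (by
      intro h g
      -- The density `w` is absorbed into the test function. Since `w` is bounded and integrates to
      -- `1` for every coupling, `f' h` is bounded with integrals bounded uniformly in `n`.
      let f' : (CodeSpace.{u} × CodeSpace.{u} → ℝ) → W₁.carrier × W₂.carrier → ℝ :=
        fun h x => h (Φ x) * w (Φ x)
      have hf'm : ∀ h : BoundedContinuousFunction (CodeSpace.{u} × CodeSpace.{u}) ℝ,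
          Measurable (f' h) := fun h =>
        (h.continuous.measurable.comp hΦ).mul (hw.measurable.comp hΦ).coe_nnreal_real
      have hf'b : ∀ (h : BoundedContinuousFunction (CodeSpace.{u} × CodeSpace.{u}) ℝ) x,
          ‖f' h x‖ₑ ≤ ‖h‖ₑ * w (Φ x) := by
        intro h x
        rw [enorm_mul]
        refine mul_le_mul' (enorm_le_iff_norm_le.2 (h.norm_coe_le_norm _)) (le_of_eq ?_)
        simp
      let B : ℝ≥0 := ‖h‖₊ * C + ‖g‖₊ * C + ‖h‖₊ + ‖g‖₊
      have hb : ∀ (h : BoundedContinuousFunction (CodeSpace.{u} × CodeSpace.{u}) ℝ),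
          ‖h‖₊ * C ≤ B → ∀ x, ‖f' h x‖ₑ ≤ B := by
        intro h hB x
        refine (hf'b h x).trans ?_
        rw [enorm_eq_nnnorm, ← ENNReal.coe_mul, ENNReal.coe_le_coe]
        exact (mul_le_mul' le_rfl (hC _)).trans hB
      have hb' : ∀ (h : BoundedContinuousFunction (CodeSpace.{u} × CodeSpace.{u}) ℝ),
          ‖h‖₊ ≤ B → ∀ n, ∫⁻ x, ‖f' h x‖ₑ ∂(ρ n) ≤ B := by
        intro h hB n
        refine (lintegral_mono (hf'b h)).trans ?_
        have hm : Measurable fun x => (w (Φ x) : ℝ≥0∞) :=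
          (hw.measurable.comp hΦ).coe_nnreal_ennreal
        rw [lintegral_const_mul _ hm, hwint n, mul_one, enorm_eq_nnnorm]
        exact ENNReal.coe_le_coe.2 hB
      refine (hlim (f' h) (f' g) B (hf'm h) (hf'm g) (hb h ?_) (hb g ?_) (hb' h ?_)
        (hb' g ?_)).congr fun n => ?_
      · exact le_add_right (le_add_right le_self_add)
      · exact le_add_right (le_add_right le_add_self)
      · exact le_add_right le_add_self
      · exact le_add_self
      have hσn := (hρ n).sigmaFinite
      have hσn' : SFinite ((ρ n).map Φ) := inferInstance
      have hdens : Measurable fun z : (CodeSpace.{u} × CodeSpace.{u}) ×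
          (CodeSpace.{u} × CodeSpace.{u}) => w z.1 * w z.2 :=
        (hw.measurable.comp measurable_fst).mul (hw.measurable.comp measurable_snd)
      have ewd : (((ρ n).map Φ).withDensity fun x => (w x : ℝ≥0∞)).prod
          (((ρ n).map Φ).withDensity fun x => (w x : ℝ≥0∞)) =
          (((ρ n).prod (ρ n)).map (Prod.map Φ Φ)).withDensity
            fun z => ((w z.1 * w z.2 : ℝ≥0) : ℝ≥0∞) := by
        rw [prod_withDensity hw.measurable.coe_nnreal_ennreal hw.measurable.coe_nnreal_ennreal,
          Measure.map_prod_map _ _ hΦ hΦ]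
        simp only [ENNReal.coe_mul]
      change _ = ∫ z, (V₁ (z.1.1, z.2.1) - V₂ (z.1.2, z.2.2)) * (h z.1 * g z.2)
        ∂((((ρ n).map Φ).withDensity fun x => (w x : ℝ≥0∞)).prod
          (((ρ n).map Φ).withDensity fun x => (w x : ℝ≥0∞)))
      rw [ewd, integral_withDensity_eq_integral_smul hdens, integral_map]
      · refine integral_congr_ae ?_
        have a₁ := ((hρ n).mp_fst.prod (hρ n).mp_fst).quasiMeasurePreserving.ae hWV₁
        have a₂ := ((hρ n).mp_snd.prod (hρ n).mp_snd).quasiMeasurePreserving.ae hWV₂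
        filter_upwards [a₁, a₂] with z hz₁ hz₂
        have hz₁ : W₁.toFun (z.1.1, z.2.1) = V₁ (φ₁ z.1.1, φ₁ z.2.1) := hz₁
        have hz₂ : W₂.toFun (z.1.2, z.2.2) = V₂ (φ₂ z.1.2, φ₂ z.2.2) := hz₂
        simp only [pullbackDiff, hz₁, hz₂, f', Φ, Prod.map_fst, Prod.map_snd, NNReal.smul_def,
          NNReal.coe_mul, smul_eq_mul]
        ring
      · exact (hΦ.prodMap hΦ).aemeasurable
      · refine Measurable.aestronglyMeasurable (hdens.smul (Measurable.mul (Measurable.sub ?_ ?_)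
          (Measurable.mul ?_ ?_)))
        · exact hV₁.comp ((measurable_fst.comp measurable_fst).prodMk
            (measurable_fst.comp measurable_snd))
        · exact hV₂.comp ((measurable_snd.comp measurable_fst).prodMk
            (measurable_snd.comp measurable_snd))
        · exact h.continuous.measurable.comp measurable_fst
        · exact g.continuous.measurable.comp measurable_snd)
  have hset : ∀ y : CodeSpace.{u}, v y ≠ 0 ↔ y.weight ≠ 0 := fun y => (hv0 y).not
  simp_rw [hset] at m₁ m₂
  exact linked_of_partialCoupling (W₁ := ⟨CodeSpace.{u}, Y₁, V₁, hs₁, hi₁⟩)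
    (W₂ := ⟨CodeSpace.{u}, Y₂, V₂, hs₂, hi₂⟩) hEm hEm m₁ m₂ hoff₁ hoff₂ hae

lemma exists_seq_coupling_of_couplingInf_eq_zero
    {N : ∀ {X : Type u} [MeasurableSpace X], Measure X → (X × X → ℝ) → ℝ≥0∞}
    (h : couplingInf N W₁ W₂ = 0) :
    ∃ ρ : ℕ → Measure (W₁.carrier × W₂.carrier), (∀ n, IsCouplingMeasure (ρ n) W₁.μ W₂.μ) ∧
      Tendsto (fun n => N (ρ n) (pullbackDiff W₁ W₂)) atTop (𝓝 0) := by
  have hex : ∀ n : ℕ, ∃ ρ, IsCouplingMeasure ρ W₁.μ W₂.μ ∧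
      N ρ (pullbackDiff W₁ W₂) < ((n : ℝ≥0∞))⁻¹ := by
    intro n
    have hpos : couplingInf N W₁ W₂ < ((n : ℝ≥0∞))⁻¹ := by
      rw [h]
      exact ENNReal.inv_pos.2 (ENNReal.natCast_ne_top n)
    simpa only [couplingInf, iInf_lt_iff, exists_prop] using hpos
  choose ρ hρ hN using hex
  refine ⟨ρ, hρ, ?_⟩
  exact tendsto_of_tendsto_of_tendsto_of_le_of_le tendsto_const_nhds
    ENNReal.tendsto_inv_nat_nhds_zero (fun _ => zero_le) fun n => (hN n).le

lemma integrable_pullbackDiff {ρ : Measure (W₁.carrier × W₂.carrier)}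
    (hρ : IsCouplingMeasure ρ W₁.μ W₂.μ) :
    Integrable (pullbackDiff W₁ W₂) (ρ.prod ρ) := by
  have := hρ.sigmaFinite
  exact ((hρ.mp_fst.prod hρ.mp_fst).integrable_comp_of_integrable W₁.integrable).sub
    ((hρ.mp_snd.prod hρ.mp_snd).integrable_comp_of_integrable W₂.integrable)

theorem linked_of_couplingInf_cutNorm_eq_zero (h : couplingInf cutNorm W₁ W₂ = 0) :
    Linked W₁ W₂ := by
  obtain ⟨ρ, hρ, hN⟩ := exists_seq_coupling_of_couplingInf_eq_zero h
  refine linked_of_tendsto hρ fun f g B hf hg hfB hgB _ _ => ?_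
  rw [tendsto_zero_iff_enorm_tendsto_zero]
  have hlim : Tendsto (fun n => ENNReal.ofReal (4 * (B : ℝ) ^ 2) *
      cutNorm (ρ n) (pullbackDiff W₁ W₂)) atTop (𝓝 0) := by
    have := ENNReal.Tendsto.const_mul (a := ENNReal.ofReal (4 * (B : ℝ) ^ 2)) hN
      (Or.inr ENNReal.ofReal_ne_top)
    simpa using this
  refine tendsto_of_tendsto_of_tendsto_of_le_of_le tendsto_const_nhds hlim (fun _ => zero_le)
    fun n => ?_
  have hσ := (hρ n).sigmaFinite
  have hF := integrable_pullbackDiff (hρ n)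
  have hreal : ∀ f : W₁.carrier × W₂.carrier → ℝ, (∀ x, ‖f x‖ₑ ≤ B) → ∀ x, |f x| ≤ B := by
    intro f hf x
    have := hf x
    rw [enorm_eq_nnnorm, ENNReal.coe_le_coe] at this
    exact_mod_cast this
  have hfin : cutNorm (ρ n) (pullbackDiff W₁ W₂) ≠ ∞ := by
    refine ne_top_of_le_ne_top hF.hasFiniteIntegral.ne ?_
    refine iSup_le fun T => iSup_le fun _ => iSup_le fun U => iSup_le fun _ => ?_
    exact (enorm_integral_le_lintegral_enorm _).trans (setLIntegral_le_lintegral _ _)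
  have key := abs_integral_mul_prod_le hF hf (hreal f hfB) (hreal g hgB) B.2 hg
    (D := (cutNorm (ρ n) (pullbackDiff W₁ W₂)).toReal) (fun T hT U hU => by
      rw [← Real.norm_eq_abs, ← toReal_enorm]
      refine ENNReal.toReal_mono hfin ?_
      exact le_iSup_of_le T (le_iSup_of_le hT (le_iSup_of_le U (le_iSup_of_le hU le_rfl))))
  rw [Real.enorm_eq_ofReal_abs, ← ENNReal.ofReal_toReal hfin, ← ENNReal.ofReal_mul (by positivity)]
  exact ENNReal.ofReal_le_ofReal key

/-- On a space of infinite mass a small `L^p` norm does not bound the cut norm, but the admissible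
test functions are bounded in the conjugate `L^q`, so Hölder suffices. -/
theorem linked_of_couplingInf_sqLpNorm_eq_zero {p : ℝ} (hp : 1 < p)
    (h : couplingInf (sqLpNorm (ENNReal.ofReal p)) W₁ W₂ = 0) : Linked W₁ W₂ := by
  obtain ⟨ρ, hρ, hN⟩ := exists_seq_coupling_of_couplingInf_eq_zero h
  refine linked_of_tendsto hρ fun f g B hf hg hfB hgB hfi hgi => ?_
  rw [tendsto_zero_iff_enorm_tendsto_zero]
  have hpq := Real.HolderConjugate.conjExponent hp
  set q := p.conjExponent
  have hq := hpq.symm.pos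
  have hlim : Tendsto (fun n => sqLpNorm (ENNReal.ofReal p) (ρ n) (pullbackDiff W₁ W₂) *
      (((B : ℝ≥0∞) ^ q) * (B : ℝ≥0∞) ^ q) ^ (1 / q)) atTop (𝓝 0) := by
    have := ENNReal.Tendsto.mul_const (b := (((B : ℝ≥0∞) ^ q) * (B : ℝ≥0∞) ^ q) ^ (1 / q)) hN
      (Or.inr (by finiteness))
    simpa using this
  refine tendsto_of_tendsto_of_tendsto_of_le_of_le tendsto_const_nhds hlim (fun _ => zero_le)
    fun n => ?_
  have hσ := (hρ n).sigmaFinite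
  exact enorm_integral_mul_prod_le hpq (integrable_pullbackDiff (hρ n)).1 hf hg hfB hgB (hfi n)
    (hgi n)

end Compactness

end Graphon

namespace Graphon

open Set Filter Topology
open scoped NNReal

/-! ### Essential parts and their invariance along chains -/

section EssentialPart

/-- The points whose row does not vanish almost everywhere, up to a null set. -/
def essSupport (W : Graphon.{u}) : Set W.carrier :=
  toMeasurable W.μ {x | ∫⁻ y, ‖W.toFun (x, y)‖ₑ ∂W.μ ≠ 0}

lemma measurableSet_essSupport (W : Graphon.{u}) : MeasurableSet W.essSupport :=
  measurableSet_toMeasurable _ _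

lemma aemeasurable_rowNorm (W : Graphon.{u}) :
    AEMeasurable (fun x => ∫⁻ y, ‖W.toFun (x, y)‖ₑ ∂W.μ) W.μ :=
  W.integrable.1.enorm.lintegral_prod_right'

lemma essSupport_ae_eq (W : Graphon.{u}) :
    W.essSupport =ᵐ[W.μ] {x | ∫⁻ y, ‖W.toFun (x, y)‖ₑ ∂W.μ ≠ 0} :=
  (W.aemeasurable_rowNorm.nullMeasurable
    (measurableSet_singleton (0 : ℝ≥0∞)).compl).toMeasurable_ae_eq

/-- The restriction of the measure to the essential support. -/
noncomputable def essMeasure (W : Graphon.{u}) : Measure W.carrier := W.μ.restrict W.essSupport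

instance (W : Graphon.{u}) : SigmaFinite W.essMeasure := by
  unfold essMeasure
  infer_instance

lemma essMeasure_le (W : Graphon.{u}) : W.essMeasure ≤ W.μ := Measure.restrict_le_self

/-- Tonelli, applied to a measurable representative, kills the rows outside the support; symmetry of
`W` does the same for columns. -/
lemma ae_eq_zero_off_essSupport (W : Graphon.{u}) :
    ∀ᵐ z ∂W.sqMeasure, z ∉ W.essSupport ×ˢ W.essSupport → W.toFun z = 0 := by
  have row : ∀ᵐ z ∂W.sqMeasure, z.1 ∉ W.essSupport → W.toFun z = 0 := by
    have h := W.integrable.1.ae_eq_mk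
    set g := W.integrable.1.mk W.toFun
    have hg : Measurable g := W.integrable.1.stronglyMeasurable_mk.measurable
    have hmeas : MeasurableSet {z | z.1 ∉ W.essSupport → g z = 0} := by
      have : {z | z.1 ∉ W.essSupport → g z = 0} = (Prod.fst ⁻¹' W.essSupport) ∪ g ⁻¹' {0} := by
        ext z
        simp only [mem_ofPred_eq, mem_union, mem_preimage, mem_singleton_iff]
        tauto
      rw [this]
      exact (measurable_fst W.measurableSet_essSupport).union (hg (measurableSet_singleton 0))
    have hgz : ∀ᵐ z ∂W.sqMeasure, z.1 ∉ W.essSupport → g z = 0 := by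
      rw [Measure.ae_prod_iff_ae_ae hmeas]
      filter_upwards [W.essSupport_ae_eq.mem_iff, Measure.ae_ae_of_ae_prod h] with x hx hxy
      by_cases hxE : x ∈ W.essSupport
      · exact ae_of_all _ fun y hy => absurd hxE hy
      · have h0 : ∫⁻ y, ‖W.toFun (x, y)‖ₑ ∂W.μ = 0 := by
          by_contra hne
          exact hxE (hx.2 hne)
        have h1 : ∫⁻ y, ‖g (x, y)‖ₑ ∂W.μ = 0 := by
          rw [← h0]
          refine lintegral_congr_ae ?_
          filter_upwards [hxy] with y hy
          rw [hy]
        have hgx : Measurable fun y => g (x, y) := hg.comp measurable_prodMk_left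
        rw [lintegral_eq_zero_iff hgx.enorm] at h1
        filter_upwards [h1] with y hy _
        simpa using hy
    filter_upwards [h, hgz] with z h1 h2 h3
    rw [h1, h2 h3]
  have col : ∀ᵐ z ∂W.sqMeasure, z.2 ∉ W.essSupport → W.toFun z = 0 := by
    have := (Measure.measurePreserving_swap (μ := W.μ) (ν := W.μ)).quasiMeasurePreserving.ae row
    filter_upwards [this] with z hz h
    rw [← hz h]
    exact W.symm z.1 z.2
  filter_upwards [row, col] with z h1 h2 h
  by_cases hz : z.1 ∈ W.essSupport
  · exact h2 fun h' => h ⟨hz, h'⟩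
  · exact h1 hz

/-- The invariant `L^q` distance between the essential parts of two graphons vanishes. -/
def EssDistZero (q : ℝ≥0∞) (W₁ W₂ : Graphon.{u}) : Prop :=
  ∀ ε : ℝ≥0∞, ε ≠ 0 → ∃ ρ : Measure (W₁.carrier × W₂.carrier),
    IsCouplingMeasure ρ W₁.essMeasure W₂.essMeasure ∧
      eLpNorm (pullbackDiff W₁ W₂) q (ρ.prod ρ) ≤ ε

variable {W₁ W₂ W₃ : Graphon.{u}} {q : ℝ≥0∞}

lemma essMeasure_prod_le (W : Graphon.{u}) :
    W.essMeasure.prod W.essMeasure ≤ W.sqMeasure :=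
  Measure.prod_mono W.essMeasure_le W.essMeasure_le

lemma aestronglyMeasurable_ess (W : Graphon.{u}) :
    AEStronglyMeasurable W.toFun (W.essMeasure.prod W.essMeasure) :=
  W.integrable.1.mono_measure W.essMeasure_prod_le

lemma aestronglyMeasurable_pullbackDiff {ρ : Measure (W₁.carrier × W₂.carrier)} [SFinite ρ]
    {μ₁ : Measure W₁.carrier} {μ₂ : Measure W₂.carrier} [SFinite μ₁] [SFinite μ₂]
    (hρ : IsCouplingMeasure ρ μ₁ μ₂)
    (h₁ : μ₁ ≪ W₁.μ) (h₂ : μ₂ ≪ W₂.μ) :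
    AEStronglyMeasurable (pullbackDiff W₁ W₂) (ρ.prod ρ) := by
  have m₁ := W₁.integrable.1.mono_ac (h₁.prod h₁)
  have m₂ := W₂.integrable.1.mono_ac (h₂.prod h₂)
  exact (m₁.comp_measurePreserving (hρ.mp_fst.prod hρ.mp_fst)).sub
    (m₂.comp_measurePreserving (hρ.mp_snd.prod hρ.mp_snd))

lemma IsCouplingMeasure.swap {S T : Type u} [MeasurableSpace S] [MeasurableSpace T]
    {ρ : Measure (S × T)} {μ₁ : Measure S} {μ₂ : Measure T} (h : IsCouplingMeasure ρ μ₁ μ₂) :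
    IsCouplingMeasure (ρ.map Prod.swap) μ₂ μ₁ := by
  constructor
  · rw [Measure.map_map measurable_fst measurable_swap, ← h.map_snd]
    rfl
  · rw [Measure.map_map measurable_snd measurable_swap, ← h.map_fst]
    rfl

lemma EssDistZero.symm (h : EssDistZero q W₁ W₂) : EssDistZero q W₂ W₁ := by
  intro ε hε
  obtain ⟨ρ, hρ, hle⟩ := h ε hε
  have hσ := hρ.sigmaFinite
  have hσ' := hρ.swap.sigmaFinite
  refine ⟨ρ.map Prod.swap, hρ.swap, ?_⟩
  rw [Measure.map_prod_map _ _ measurable_swap measurable_swap, eLpNorm_map_measure]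
  · refine le_of_eq_of_le ?_ hle
    rw [← eLpNorm_neg]
    congr 1
    ext z
    simp [pullbackDiff]
  · rw [← Measure.map_prod_map _ _ measurable_swap measurable_swap]
    exact aestronglyMeasurable_pullbackDiff hρ.swap W₂.essMeasure_le.absolutelyContinuous
      W₁.essMeasure_le.absolutelyContinuous
  · exact (measurable_swap.prodMap measurable_swap).aemeasurable

/-- If the essential parts correspond to each other under a map, then their distance vanishes. -/
lemma essDistZero_of_map {φ : W₁.carrier → W₂.carrier} (hφ : Measurable φ)
    (hmap : W₁.essMeasure.map φ = W₂.essMeasure)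
    (hW : ∀ᵐ z ∂W₁.sqMeasure, W₁.toFun z = W₂.toFun (φ z.1, φ z.2)) : EssDistZero q W₁ W₂ := by
  intro ε _
  -- The coupling carried by the graph of `φ` makes the difference vanish a.e.
  have hg : Measurable fun x => (x, φ x) := measurable_id.prodMk hφ
  have hc : IsCouplingMeasure (W₁.essMeasure.map fun x => (x, φ x)) W₁.essMeasure
      W₂.essMeasure := by
    constructor
    · rw [Measure.map_map measurable_fst hg]
      exact Measure.map_id
    · rw [Measure.map_map measurable_snd hg, ← hmap]
      rfl
  have hσ := hc.sigmaFinite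
  refine ⟨_, hc, ?_⟩
  have h0 : eLpNorm (pullbackDiff W₁ W₂) q
      ((W₁.essMeasure.map fun x => (x, φ x)).prod (W₁.essMeasure.map fun x => (x, φ x))) = 0 := by
    have hm := aestronglyMeasurable_pullbackDiff hc W₁.essMeasure_le.absolutelyContinuous
      W₂.essMeasure_le.absolutelyContinuous
    rw [Measure.map_prod_map _ _ hg hg] at hm ⊢
    rw [eLpNorm_map_measure hm (hg.prodMap hg).aemeasurable, ← eLpNorm_zero (p := q)
      (μ := W₁.essMeasure.prod W₁.essMeasure) (α := W₁.carrier × W₁.carrier) (ε := ℝ)]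
    refine eLpNorm_congr_ae ?_
    filter_upwards [(Measure.absolutelyContinuous_of_le W₁.essMeasure_prod_le).ae_le hW] with z hz
    simp only [pullbackDiff, Function.comp_apply, Prod.map_fst, Prod.map_snd, Pi.zero_apply]
    rw [← hz, sub_self]
  rw [h0]
  exact zero_le

/-- Gluing of couplings along a step approximation of the middle graphon. -/
lemma EssDistZero.trans (hq : 1 ≤ q) (hq' : q ≠ ∞) (hL : MemLp W₂.toFun q W₂.sqMeasure)
    (h₁₂ : EssDistZero q W₁ W₂) (h₂₃ : EssDistZero q W₂ W₃) : EssDistZero q W₁ W₃ := by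
  intro ε hε
  have hε4 : ε / 2 / 2 ≠ 0 :=
    (ENNReal.div_pos (ENNReal.div_pos hε (by norm_num)).ne' (by norm_num)).ne'
  obtain ⟨ρ, hρ, hρε⟩ := h₁₂ (ε / 2 / 2) hε4
  obtain ⟨τ, hτ, hτε⟩ := h₂₃ (ε / 2 / 2) hε4
  have hL' : MemLp W₂.toFun q (W₂.essMeasure.prod W₂.essMeasure) :=
    hL.mono_measure W₂.essMeasure_prod_le
  obtain ⟨g, ⟨a, c, ha, ha', rfl⟩, hg⟩ := hL'.exists_isStep_eLpNorm_sub_le hq' hε4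
  have hσ := hρ.sigmaFinite
  have hσ' := hτ.sigmaFinite
  have haρ : ρ.map (fun x => a x.2) = W₂.essMeasure.map a := by
    rw [← hρ.map_snd, Measure.map_map ha measurable_snd]
    rfl
  have haτ : τ.map (fun x => a x.1) = W₂.essMeasure.map a := by
    rw [← hτ.map_fst, Measure.map_map ha measurable_fst]
    rfl
  -- Under `Θ` the two middle points need not coincide; they merely lie in the same cell of the
  -- partition `a`.
  obtain ⟨Θ, h1, h2, hae⟩ := exists_coupling_over_nat (ha.comp measurable_snd)
    (ha.comp measurable_fst) (haρ.trans haτ.symm) (fun n => by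
      change ρ (Prod.snd ⁻¹' (a ⁻¹' {n})) ≠ ∞
      rw [← Measure.map_apply measurable_snd (ha (measurableSet_singleton n)), hρ.map_snd]
      exact ha' n)
  have mp1 : MeasurePreserving Prod.fst Θ ρ := ⟨measurable_fst, h1⟩
  have mp2 : MeasurePreserving Prod.snd Θ τ := ⟨measurable_snd, h2⟩
  have hσΘ : SigmaFinite Θ := by
    refine SigmaFinite.of_map Θ measurable_fst.aemeasurable ?_
    rw [h1]
    infer_instance
  let e : (W₁.carrier × W₂.carrier) × (W₂.carrier × W₃.carrier) → W₁.carrier × W₃.carrier :=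
    fun x => (x.1.1, x.2.2)
  have he : Measurable e := (measurable_fst.comp measurable_fst).prodMk
    (measurable_snd.comp measurable_snd)
  have hc : IsCouplingMeasure (Θ.map e) W₁.essMeasure W₃.essMeasure := by
    constructor
    · rw [Measure.map_map measurable_fst he]
      exact (hρ.mp_fst.comp mp1).map_eq
    · rw [Measure.map_map measurable_snd he]
      exact (hτ.mp_snd.comp mp2).map_eq
  have hσc := hc.sigmaFinite
  refine ⟨Θ.map e, hc, ?_⟩
  have hm := aestronglyMeasurable_pullbackDiff hc W₁.essMeasure_le.absolutelyContinuous
    W₃.essMeasure_le.absolutelyContinuous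
  have hmρ := aestronglyMeasurable_pullbackDiff hρ W₁.essMeasure_le.absolutelyContinuous
    W₂.essMeasure_le.absolutelyContinuous
  have hmτ := aestronglyMeasurable_pullbackDiff hτ W₂.essMeasure_le.absolutelyContinuous
    W₃.essMeasure_le.absolutelyContinuous
  have hmg : AEStronglyMeasurable (W₂.toFun - fun z => c (a z.1, a z.2))
      (W₂.essMeasure.prod W₂.essMeasure) := by
    refine W₂.aestronglyMeasurable_ess.sub (Measurable.aestronglyMeasurable ?_)
    exact (Measurable.of_discrete (f := c)).comp
      ((ha.comp measurable_fst).prodMk (ha.comp measurable_snd))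
  rw [Measure.map_prod_map _ _ he he] at hm ⊢
  rw [eLpNorm_map_measure hm (he.prodMap he).aemeasurable]
  let G := W₂.toFun - fun z => c (a z.1, a z.2)
  have mA := mp1.prod mp1
  have mB := mp2.prod mp2
  have mC := (hρ.mp_snd.comp mp1).prod (hρ.mp_snd.comp mp1)
  have mD := (hτ.mp_fst.comp mp2).prod (hτ.mp_fst.comp mp2)
  -- The step function takes the same value at both pairs of middle points and cancels. Four terms
  -- remain, each at most `ε / 4`: the two given differences and the approximation error `G` at
  -- either pair.
  have hsum : (pullbackDiff W₁ W₃ ∘ Prod.map e e) =ᵐ[Θ.prod Θ]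
      (pullbackDiff W₁ W₂ ∘ Prod.map Prod.fst Prod.fst +
        G ∘ Prod.map (Prod.snd ∘ Prod.fst) (Prod.snd ∘ Prod.fst)) +
      (pullbackDiff W₂ W₃ ∘ Prod.map Prod.snd Prod.snd -
        G ∘ Prod.map (Prod.fst ∘ Prod.snd) (Prod.fst ∘ Prod.snd)) := by
    have i1 := (Measure.quasiMeasurePreserving_fst (μ := Θ) (ν := Θ)).ae hae
    have i2 := (Measure.quasiMeasurePreserving_snd (μ := Θ) (ν := Θ)).ae hae
    filter_upwards [i1, i2] with z hz1 hz2
    have hz1 : a z.1.1.2 = a z.1.2.1 := hz1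
    have hz2 : a z.2.1.2 = a z.2.2.1 := hz2
    simp only [Function.comp_apply, Pi.add_apply, Pi.sub_apply, pullbackDiff, G,
      Prod.map_apply', e, hz1, hz2]
    ring
  rw [eLpNorm_congr_ae hsum]
  have hGC := (hmg.comp_measurePreserving mC)
  have hGD := (hmg.comp_measurePreserving mD)
  have hA := hmρ.comp_measurePreserving mA
  have hB := hmτ.comp_measurePreserving mB
  calc _ ≤ _ := eLpNorm_add_le (hA.add hGC) (hB.sub hGD) hq
    _ ≤ (ε / 2 / 2 + ε / 2 / 2) + (ε / 2 / 2 + ε / 2 / 2) := by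
      refine add_le_add ((eLpNorm_add_le hA hGC hq).trans (add_le_add ?_ ?_))
        ((eLpNorm_sub_le hB hGD hq).trans (add_le_add ?_ ?_))
      · exact (eLpNorm_comp_measurePreserving hmρ mA).trans_le hρε
      · exact (eLpNorm_comp_measurePreserving hmg mC).trans_le hg
      · exact (eLpNorm_comp_measurePreserving hmτ mB).trans_le hτε
      · exact (eLpNorm_comp_measurePreserving hmg mD).trans_le hg
    _ = ε := by
      rw [ENNReal.add_halves, ENNReal.add_halves]

/-- Almost every row of the pull-back has the same integral as the corresponding row of `W₂`, so the
essential supports correspond up to a null set. -/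
lemma IsPullback.essDistZero (h : IsPullback W₁ W₂) : EssDistZero q W₁ W₂ := by
  obtain ⟨φ, hφ, hW⟩ := h
  refine essDistZero_of_map hφ.measurable ?_ hW
  have hrow : ∀ᵐ x ∂W₁.μ, ∫⁻ y, ‖W₁.toFun (x, y)‖ₑ ∂W₁.μ =
      ∫⁻ y, ‖W₂.toFun (φ x, y)‖ₑ ∂W₂.μ := by
    have hm : ∀ᵐ x ∂W₂.μ, AEStronglyMeasurable (fun y => W₂.toFun (x, y)) W₂.μ :=
      W₂.integrable.1.prodMk_left
    filter_upwards [Measure.ae_ae_of_ae_prod hW, hφ.quasiMeasurePreserving.ae hm] with x hx hx'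
    rw [lintegral_congr_ae (hx.mono fun y hy => congrArg (‖·‖ₑ) hy), ← hφ.map_eq,
      lintegral_map' _ hφ.measurable.aemeasurable]
    rw [hφ.map_eq]
    exact hx'.enorm
  have hE : W₁.essSupport =ᵐ[W₁.μ] φ ⁻¹' W₂.essSupport := by
    have h2 : ∀ᵐ x ∂W₁.μ, φ x ∈ W₂.essSupport ↔ ∫⁻ y, ‖W₂.toFun (φ x, y)‖ₑ ∂W₂.μ ≠ 0 :=
      hφ.quasiMeasurePreserving.ae W₂.essSupport_ae_eq.mem_iff
    refine eventuallyEq_set.2 ?_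
    filter_upwards [W₁.essSupport_ae_eq.mem_iff, h2, hrow] with x a1 a2 a3
    rw [mem_preimage, a1, a2, a3]
  rw [essMeasure, essMeasure, Measure.restrict_congr_set hE, ← hφ.map_eq,
    Measure.restrict_map hφ.measurable W₂.measurableSet_essSupport]

lemma IsTrivialExtension.measurePreserving {ι : W₁.carrier → W₂.carrier}
    (hι : MeasurableEmbedding ι) (hμ : W₁.μ = W₂.μ.comap ι) :
    W₁.μ.map ι = W₂.μ.restrict (range ι) := by
  rw [hμ, hι.map_comap]

/-- Added points have zero rows and old rows keep their integrals, so the extension adds nothing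
essential. -/
lemma IsTrivialExtension.essDistZero (h : IsTrivialExtension W₂ W₁) : EssDistZero q W₁ W₂ := by
  obtain ⟨ι, hι, hμ, hW, h0⟩ := h
  refine essDistZero_of_map hι.measurable ?_ (ae_of_all _ fun z => (hW z.1 z.2).symm)
  have hmap := IsTrivialExtension.measurePreserving hι hμ
  have hrow : ∀ x, ∫⁻ y, ‖W₂.toFun (ι x, y)‖ₑ ∂W₂.μ = ∫⁻ y, ‖W₁.toFun (x, y)‖ₑ ∂W₁.μ := by
    intro x
    have : ∫⁻ y, ‖W₂.toFun (ι x, y)‖ₑ ∂W₂.μ = ∫⁻ y in range ι, ‖W₂.toFun (ι x, y)‖ₑ ∂W₂.μ := by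
      rw [← lintegral_indicator hι.measurableSet_range]
      refine lintegral_congr fun y => ?_
      by_cases hy : y ∈ range ι
      · rw [indicator_of_mem hy]
      · rw [indicator_of_notMem hy, h0 _ _ (Or.inr hy), enorm_zero]
    rw [this, ← hmap, hι.lintegral_map]
    simp_rw [hW]
  have hoff : ∀ᵐ x ∂W₂.μ, x ∈ W₂.essSupport → x ∈ range ι := by
    filter_upwards [W₂.essSupport_ae_eq.mem_iff] with x hx hxE
    by_contra hr
    refine hx.1 hxE ?_
    simp [h0 x _ (Or.inl hr)]
  have hE : W₁.essSupport =ᵐ[W₁.μ] ι ⁻¹' W₂.essSupport := by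
    have h2 : ∀ᵐ x ∂W₁.μ, ι x ∈ W₂.essSupport ↔ ∫⁻ y, ‖W₂.toFun (ι x, y)‖ₑ ∂W₂.μ ≠ 0 := by
      have h3 : ∀ᵐ x ∂(W₁.μ.map ι), x ∈ W₂.essSupport ↔
          x ∈ {x | ∫⁻ y, ‖W₂.toFun (x, y)‖ₑ ∂W₂.μ ≠ 0} := by
        rw [hmap]
        exact ae_restrict_of_ae W₂.essSupport_ae_eq.mem_iff
      exact ae_of_ae_map hι.measurable.aemeasurable h3
    refine eventuallyEq_set.2 ?_
    filter_upwards [W₁.essSupport_ae_eq.mem_iff, h2] with x a1 a2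
    rw [mem_preimage, a1, a2, hrow]
  rw [essMeasure, essMeasure, Measure.restrict_congr_set hE,
    ← Measure.restrict_map hι.measurable W₂.measurableSet_essSupport, hmap,
    Measure.restrict_restrict W₂.measurableSet_essSupport]
  refine Measure.restrict_congr_set (eventuallyEq_set.2 ?_)
  filter_upwards [hoff] with x hx
  exact ⟨fun h => h.1, fun h => ⟨h, hx h⟩⟩

lemma IsPullback.memLp_iff (h : IsPullback W₁ W₂) :
    MemLp W₁.toFun q W₁.sqMeasure ↔ MemLp W₂.toFun q W₂.sqMeasure := by
  obtain ⟨φ, hφ, hW⟩ := h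
  rw [memLp_congr_ae hW]
  have mp := hφ.prod hφ
  constructor
  · intro h
    refine ⟨W₂.integrable.1, ?_⟩
    have := eLpNorm_comp_measurePreserving (p := q) W₂.integrable.1 mp
    rw [← this]
    exact h.2
  · intro h
    exact h.comp_measurePreserving mp

lemma IsTrivialExtension.memLp_iff (h : IsTrivialExtension W₂ W₁) :
    MemLp W₁.toFun q W₁.sqMeasure ↔ MemLp W₂.toFun q W₂.sqMeasure := by
  obtain ⟨ι, hι, hμ, hW, h0⟩ := h
  have hmap := IsTrivialExtension.measurePreserving hι hμ
  have hιι : MeasurableEmbedding (Prod.map ι ι) := hι.prodMap hι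
  have h1 : MemLp W₂.toFun q W₂.sqMeasure ↔
      MemLp W₂.toFun q (W₂.sqMeasure.restrict (range ι ×ˢ range ι)) := by
    rw [← memLp_indicator_iff_restrict (hι.measurableSet_range.prod hι.measurableSet_range)]
    have : (range ι ×ˢ range ι).indicator W₂.toFun = W₂.toFun := by
      refine indicator_eq_self.2 fun z hz => ?_
      by_contra hcon
      refine hz (h0 z.1 z.2 ?_)
      by_contra hno
      exact hcon ⟨by_contra fun h => hno (Or.inl h), by_contra fun h => hno (Or.inr h)⟩
    rw [this]
  rw [h1, ← Measure.prod_restrict, ← hmap, Measure.map_prod_map _ _ hι.measurable hι.measurable,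
    hιι.memLp_map_measure_iff]
  have : W₂.toFun ∘ Prod.map ι ι = W₁.toFun := funext fun z => hW z.1 z.2
  rw [this]

lemma ElemEquiv.essDistZero (h : ElemEquiv W₁ W₂) : EssDistZero q W₁ W₂ := by
  rcases h with (h | h) | (h | h)
  · exact h.essDistZero
  · exact h.essDistZero.symm
  · exact h.essDistZero.symm
  · exact h.essDistZero

lemma ElemEquiv.memLp_iff (h : ElemEquiv W₁ W₂) :
    MemLp W₁.toFun q W₁.sqMeasure ↔ MemLp W₂.toFun q W₂.sqMeasure := by
  rcases h with (h | h) | (h | h)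
  · exact h.memLp_iff
  · exact h.memLp_iff.symm
  · exact h.memLp_iff.symm
  · exact h.memLp_iff

lemma IsPullback.refl (W : Graphon.{u}) : IsPullback W W :=
  ⟨fun x => x, MeasurePreserving.id _, Filter.EventuallyEq.rfl⟩

/-- Membership in `L^q` is carried through the induction because transitivity requires it of the
middle graphon. -/
lemma Linked.essDistZero (hq : 1 ≤ q) (hq' : q ≠ ∞) (hL : MemLp W₁.toFun q W₁.sqMeasure)
    (h : Linked W₁ W₂) : EssDistZero q W₁ W₂ ∧ MemLp W₂.toFun q W₂.sqMeasure := by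
  induction h with
  | refl => exact ⟨(IsPullback.refl W₁).essDistZero, hL⟩
  | tail _ h ih => exact ⟨ih.1.trans hq hq' ih.2 h.essDistZero, h.memLp_iff.1 ih.2⟩

end EssentialPart

end Graphon

namespace Graphon

open Set Filter Topology
open scoped NNReal

/-! ### From essential parts back to full couplings -/

section Recoupling

variable {W₁ W₂ : Graphon.{u}}

/-- Continuity from above for the finite measure with density `f`, along complements of squares of
spanning sets. -/
lemma exists_finite_square_lintegral_compl_le {S : Type*} [MeasurableSpace S] (μ : Measure S)
    [SigmaFinite μ] {f : S × S → ℝ≥0∞} (hf : ∫⁻ z, f z ∂(μ.prod μ) ≠ ∞) {ε : ℝ≥0∞} (hε : ε ≠ 0) :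
    ∃ A : Set S, MeasurableSet A ∧ μ A ≠ ∞ ∧ ∫⁻ z in (A ×ˢ A)ᶜ, f z ∂(μ.prod μ) ≤ ε := by
  have hF : IsFiniteMeasure ((μ.prod μ).withDensity f) := isFiniteMeasure_withDensity hf
  have hm : ∀ n, MeasurableSet (spanningSets μ n ×ˢ spanningSets μ n) := fun n =>
    (measurableSet_spanningSets μ n).prod (measurableSet_spanningSets μ n)
  have hmono : Monotone fun n => spanningSets μ n ×ˢ spanningSets μ n := fun i j hij =>
    prod_mono (monotone_spanningSets μ hij) (monotone_spanningSets μ hij)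
  have hT := tendsto_measure_iInter_atTop (μ := (μ.prod μ).withDensity f)
    (fun n => (hm n).compl.nullMeasurableSet)
    (fun i j hij => compl_subset_compl.2 (hmono hij)) ⟨0, measure_ne_top _ _⟩
  have hU : ⋂ n, (spanningSets μ n ×ˢ spanningSets μ n)ᶜ = ∅ := by
    rw [← compl_iUnion, iUnion_prod_of_monotone (monotone_spanningSets μ)
      (monotone_spanningSets μ), iUnion_spanningSets, univ_prod_univ, compl_univ]
  rw [hU, measure_empty] at hT
  obtain ⟨n, hn⟩ := (hT.eventually (gt_mem_nhds (pos_iff_ne_zero.2 hε))).exists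
  refine ⟨spanningSets μ n, measurableSet_spanningSets μ n, (measure_spanningSets_lt_top μ n).ne,
    ?_⟩
  rw [← withDensity_apply _ (hm n).compl]
  exact hn.le

/-- The `q`-th power of a graphon, integrated over the part of a coupling that does not belong to
the coupling `ρ₀` of the essential parts restricted to `D`. -/
lemma lintegral_remainder (W : Graphon.{u}) {X : Type*} [MeasurableSpace X] {ρ ρ₀ : Measure X}
    [SFinite ρ] [SFinite ρ₀] {π : X → W.carrier} (h : MeasurePreserving π ρ W.μ)
    (h₀ : MeasurePreserving π ρ₀ W.essMeasure) {r : ℝ} (hr : 0 < r)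
    (hfin : ∫⁻ z, ‖W.toFun z‖ₑ ^ r ∂W.sqMeasure ≠ ∞) {T : Measure (X × X)} {D : Set (X × X)}
    (hD : MeasurableSet D) (hT : ρ.prod ρ = T + (ρ₀.prod ρ₀).restrict D) :
    ∫⁻ z, ‖W.toFun (π z.1, π z.2)‖ₑ ^ r ∂T =
      ∫⁻ z in Dᶜ, ‖W.toFun (π z.1, π z.2)‖ₑ ^ r ∂(ρ₀.prod ρ₀) := by
  have hm : AEMeasurable (fun z => ‖W.toFun z‖ₑ ^ r) W.sqMeasure :=
    W.integrable.1.enorm.pow_const r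
  have e1 : ∫⁻ z, ‖W.toFun (π z.1, π z.2)‖ₑ ^ r ∂(ρ.prod ρ) =
      ∫⁻ z, ‖W.toFun z‖ₑ ^ r ∂W.sqMeasure := by
    have mp := h.prod h
    rw [sqMeasure, ← mp.map_eq, lintegral_map' (by rw [mp.map_eq]; exact hm)
      mp.measurable.aemeasurable]
    rfl
  have e2 : ∫⁻ z, ‖W.toFun (π z.1, π z.2)‖ₑ ^ r ∂(ρ₀.prod ρ₀) =
      ∫⁻ z, ‖W.toFun z‖ₑ ^ r ∂(W.essMeasure.prod W.essMeasure) := by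
    have mp := h₀.prod h₀
    rw [← mp.map_eq, lintegral_map' (by
      rw [mp.map_eq]; exact hm.mono_measure W.essMeasure_prod_le) mp.measurable.aemeasurable]
    rfl
  have e3 : ∫⁻ z, ‖W.toFun z‖ₑ ^ r ∂(W.essMeasure.prod W.essMeasure) =
      ∫⁻ z, ‖W.toFun z‖ₑ ^ r ∂W.sqMeasure := by
    rw [essMeasure, Measure.prod_restrict, ← lintegral_indicator
      (W.measurableSet_essSupport.prod W.measurableSet_essSupport)]
    refine lintegral_congr_ae ?_
    filter_upwards [W.ae_eq_zero_off_essSupport] with z hz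
    by_cases hzE : z ∈ W.essSupport ×ˢ W.essSupport
    · rw [indicator_of_mem hzE]
    · rw [indicator_of_notMem hzE, hz hzE, enorm_zero, ENNReal.zero_rpow_of_pos hr]
  rw [hT, lintegral_add_measure, ← e3, ← e2,
    ← lintegral_add_compl (μ := ρ₀.prod ρ₀) _ hD, add_comm] at e1
  -- Both couplings give the full integral of `‖W‖ₑ ^ r`, since nothing lies outside the essential
  -- part; the common finite contribution of `D` cancels.
  refine (ENNReal.add_right_inj ?_).1 e1
  refine ne_top_of_le_ne_top ?_ (setLIntegral_le_lintegral _ _)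
  rwa [e2, e3]

/-- A coupling of the essential parts of two graphons of equal mass yields couplings of the
graphons themselves with nearly the same distance. -/
theorem exists_coupling_of_essDistZero {r : ℝ} (hr : 1 ≤ r)
    (hmass : W₁.μ univ = W₂.μ univ)
    (hL₁ : MemLp W₁.toFun (ENNReal.ofReal r) W₁.sqMeasure)
    (hL₂ : MemLp W₂.toFun (ENNReal.ofReal r) W₂.sqMeasure)
    (h : EssDistZero (ENNReal.ofReal r) W₁ W₂) {ε : ℝ≥0∞} (hε : ε ≠ 0) :
    ∃ ρ, IsCouplingMeasure ρ W₁.μ W₂.μ ∧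
      ∫⁻ z, ‖pullbackDiff W₁ W₂ z‖ₑ ^ r ∂(ρ.prod ρ) ≤ ε := by
  have hr0 : 0 < r := zero_lt_one.trans_le hr
  have hr0' : ENNReal.ofReal r ≠ 0 := (ENNReal.ofReal_pos.2 hr0).ne'
  have hpow : ∀ {α : Type u} [MeasurableSpace α] (ν : Measure α) (f : α → ℝ),
      eLpNorm f (ENNReal.ofReal r) ν = (∫⁻ x, ‖f x‖ₑ ^ r ∂ν) ^ (1 / r) := fun ν f => by
    rw [eLpNorm_eq_lintegral_rpow_enorm_toReal hr0' ENNReal.ofReal_ne_top,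
      ENNReal.toReal_ofReal hr0.le]
  have hfin : ∀ W : Graphon.{u}, MemLp W.toFun (ENNReal.ofReal r) W.sqMeasure →
      ∫⁻ z, ‖W.toFun z‖ₑ ^ r ∂W.sqMeasure ≠ ∞ := fun W hW => by
    have := lintegral_rpow_enorm_lt_top_of_eLpNorm_lt_top hr0' ENNReal.ofReal_ne_top hW.2
    rw [ENNReal.toReal_ofReal hr0.le] at this
    exact this.ne
  set K : ℝ≥0∞ := 2 ^ (r - 1)
  have hKtop : K ≠ ∞ := ENNReal.rpow_ne_top_of_nonneg (by linarith) (by norm_num)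
  -- The constant collects the final estimate: one `δ` on the retained square, and off it `K` times
  -- the sum of `δ` for `W₁` and `K * (δ + δ)` for `W₂`, with `K` from `(a + b)^r ≤ 2^(r-1) (a^r +
  -- b^r)`.
  obtain ⟨δ, hδ, hδε⟩ := ENNReal.exists_nnreal_pos_mul_lt
    (a := K * (1 + K * (1 + 1)) + 1) (by finiteness) hε
  have hδ0 : (δ : ℝ≥0∞) ≠ 0 := by exact_mod_cast hδ.ne'
  obtain ⟨ρ₀, hρ₀, hle⟩ := h ((δ : ℝ≥0∞) ^ (1 / r)) (by
    rw [Ne, ENNReal.rpow_eq_zero_iff_of_pos (by positivity)]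
    exact hδ0)
  have hσ₀ := hρ₀.sigmaFinite
  rw [hpow, ENNReal.rpow_le_rpow_iff (by positivity)] at hle
  obtain ⟨A, hA, hAfin, hAδ⟩ := exists_finite_square_lintegral_compl_le W₁.μ (hfin W₁ hL₁) hδ0
  let B : Set (W₁.carrier × W₂.carrier) := Prod.fst ⁻¹' A
  have hB : MeasurableSet B := measurable_fst hA
  have hBfin : ρ₀ B ≠ ∞ := by
    have : ρ₀ B = W₁.essMeasure A := hρ₀.mp_fst.measure_preimage hA.nullMeasurableSet
    rw [this]
    exact ne_top_of_le_ne_top hAfin (W₁.essMeasure_le A)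
  let ρ₁ := ρ₀.restrict B
  have hF₁ : IsFiniteMeasure ρ₁ := isFiniteMeasure_restrict.2 hBfin
  have hle₁ : ρ₁.map Prod.fst ≤ W₁.μ :=
    ((Measure.map_mono Measure.restrict_le_self measurable_fst).trans_eq hρ₀.map_fst).trans
      W₁.essMeasure_le
  have hle₂ : ρ₁.map Prod.snd ≤ W₂.μ :=
    ((Measure.map_mono Measure.restrict_le_self measurable_snd).trans_eq hρ₀.map_snd).trans
      W₂.essMeasure_le
  have hadd₁ := Measure.sub_add_cancel_of_le hle₁
  have hadd₂ := Measure.sub_add_cancel_of_le hle₂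
  -- Finiteness of `ρ₁` allows the cancellation. Without the cut to `B` the leftovers could have
  -- different masses when the total is infinite.
  have hd : (W₁.μ - ρ₁.map Prod.fst) univ = (W₂.μ - ρ₁.map Prod.snd) univ := by
    rw [← hadd₁, ← hadd₂, Measure.add_apply, Measure.add_apply,
      Measure.map_apply measurable_fst MeasurableSet.univ,
      Measure.map_apply measurable_snd MeasurableSet.univ, preimage_univ, preimage_univ,
      ENNReal.add_left_inj (measure_ne_top _ _)] at hmass
    exact hmass
  have hs₁ := Measure.sigmaFinite_of_le W₁.μ (Measure.sub_le (ν := ρ₁.map Prod.fst))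
  have hs₂ := Measure.sigmaFinite_of_le W₂.μ (Measure.sub_le (ν := ρ₁.map Prod.snd))
  obtain ⟨κ, hκ₁, hκ₂⟩ := exists_coupling _ _ hd
  have hσκ : SigmaFinite κ := by
    refine SigmaFinite.of_map κ measurable_fst.aemeasurable ?_
    rw [hκ₁]
    infer_instance
  have hc : IsCouplingMeasure (κ + ρ₁) W₁.μ W₂.μ := by
    constructor
    · rw [Measure.map_add _ _ measurable_fst, hκ₁, hadd₁]
    · rw [Measure.map_add _ _ measurable_snd, hκ₂, hadd₂]
  refine ⟨κ + ρ₁, hc, ?_⟩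
  let T : Measure ((W₁.carrier × W₂.carrier) × (W₁.carrier × W₂.carrier)) :=
    κ.prod κ + (ρ₁.prod κ + κ.prod ρ₁)
  have hT : (κ + ρ₁).prod (κ + ρ₁) = T + (ρ₀.prod ρ₀).restrict (B ×ˢ B) := by
    rw [Measure.prod_add, Measure.add_prod, Measure.add_prod, ← Measure.prod_restrict]
    simp only [T, ρ₁, add_assoc]
  have hTle : T ≤ (κ + ρ₁).prod (κ + ρ₁) := hT ▸ Measure.le_add_right le_rfl
  have R₁ := W₁.lintegral_remainder hc.mp_fst hρ₀.mp_fst hr0 (hfin W₁ hL₁) (hB.prod hB) hT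
  have R₂ := W₂.lintegral_remainder hc.mp_snd hρ₀.mp_snd hr0 (hfin W₂ hL₂) (hB.prod hB) hT
  have ineq : ∀ a b : ℝ, ‖a - b‖ₑ ^ r ≤ K * (‖a‖ₑ ^ r + ‖b‖ₑ ^ r) := fun a b =>
    (ENNReal.rpow_le_rpow enorm_sub_le hr0.le).trans
      (ENNReal.rpow_add_le_mul_rpow_add_rpow _ _ hr)
  have mW₁ : AEMeasurable (fun z : (W₁.carrier × W₂.carrier) × (W₁.carrier × W₂.carrier) =>
      ‖W₁.toFun (z.1.1, z.2.1)‖ₑ ^ r) ((κ + ρ₁).prod (κ + ρ₁)) :=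
    (W₁.integrable.1.comp_measurePreserving (hc.mp_fst.prod hc.mp_fst)).enorm.pow_const r
  have mW₁' : AEMeasurable (fun z : (W₁.carrier × W₂.carrier) × (W₁.carrier × W₂.carrier) =>
      ‖W₁.toFun (z.1.1, z.2.1)‖ₑ ^ r) (ρ₀.prod ρ₀) :=
    (W₁.aestronglyMeasurable_ess.comp_measurePreserving
      (hρ₀.mp_fst.prod hρ₀.mp_fst)).enorm.pow_const r
  have b₁ : ∫⁻ z in (B ×ˢ B)ᶜ, ‖W₁.toFun (z.1.1, z.2.1)‖ₑ ^ r ∂(ρ₀.prod ρ₀) ≤ δ := by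
    refine le_trans ?_ hAδ
    have mp := hρ₀.mp_fst.prod hρ₀.mp_fst
    have hAA : MeasurableSet (A ×ˢ A)ᶜ := (hA.prod hA).compl
    calc _ = ∫⁻ z in (A ×ˢ A)ᶜ, ‖W₁.toFun z‖ₑ ^ r ∂(W₁.essMeasure.prod W₁.essMeasure) := by
          rw [← mp.map_eq, Measure.restrict_map mp.measurable hAA,
            lintegral_map' ?_ mp.measurable.aemeasurable]
          · rfl
          · rw [← Measure.restrict_map mp.measurable hAA, mp.map_eq]
            exact (W₁.aestronglyMeasurable_ess.enorm.pow_const r).restrict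
      _ ≤ _ := lintegral_mono' (Measure.restrict_mono le_rfl W₁.essMeasure_prod_le) le_rfl
  -- The set `A` was chosen for `W₁` alone; smallness passes to `W₂`, which is `W₁` minus the
  -- difference.
  have b₂ : ∫⁻ z in (B ×ˢ B)ᶜ, ‖W₂.toFun (z.1.2, z.2.2)‖ₑ ^ r ∂(ρ₀.prod ρ₀) ≤
      K * (δ + δ) := by
    calc _ ≤ ∫⁻ z in (B ×ˢ B)ᶜ, K * (‖W₁.toFun (z.1.1, z.2.1)‖ₑ ^ r +
          ‖pullbackDiff W₁ W₂ z‖ₑ ^ r) ∂(ρ₀.prod ρ₀) := by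
          refine lintegral_mono fun z => ?_
          have := ineq (W₁.toFun (z.1.1, z.2.1)) (pullbackDiff W₁ W₂ z)
          rwa [pullbackDiff, sub_sub_cancel] at this
      _ = K * ((∫⁻ z in (B ×ˢ B)ᶜ, ‖W₁.toFun (z.1.1, z.2.1)‖ₑ ^ r ∂(ρ₀.prod ρ₀)) +
          ∫⁻ z in (B ×ˢ B)ᶜ, ‖pullbackDiff W₁ W₂ z‖ₑ ^ r ∂(ρ₀.prod ρ₀)) := by
          rw [lintegral_const_mul' _ _ hKtop, lintegral_add_left' mW₁'.restrict]
      _ ≤ K * (δ + δ) := by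
          gcongr
          exact (setLIntegral_le_lintegral _ _).trans hle
  rw [hT, lintegral_add_measure]
  calc _ ≤ K * (δ + K * (δ + δ)) + δ := by
        refine add_le_add ?_ ((setLIntegral_le_lintegral _ _).trans hle)
        refine (lintegral_mono (μ := T) (f := fun z => ‖pullbackDiff W₁ W₂ z‖ₑ ^ r) fun z =>
          ineq (W₁.toFun (z.1.1, z.2.1)) (W₂.toFun (z.1.2, z.2.2))).trans ?_
        rw [lintegral_const_mul' _ _ hKtop, lintegral_add_left' (mW₁.mono_measure hTle)]
        gcongr
        · exact R₁.trans_le b₁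
        · exact R₂.trans_le b₂
    _ = δ * (K * (1 + K * (1 + 1)) + 1) := by ring
    _ ≤ ε := hδε.le

theorem couplingInf_eq_zero_of_essDistZero {r : ℝ} (hr : 1 ≤ r)
    (hmass : W₁.μ univ = W₂.μ univ)
    (hL₁ : MemLp W₁.toFun (ENNReal.ofReal r) W₁.sqMeasure)
    (hL₂ : MemLp W₂.toFun (ENNReal.ofReal r) W₂.sqMeasure)
    (h : EssDistZero (ENNReal.ofReal r) W₁ W₂) :
    couplingInf (sqLpNorm (ENNReal.ofReal r)) W₁ W₂ = 0 := by
  have hr0 : 0 < r := zero_lt_one.trans_le hr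
  refine le_antisymm (ENNReal.le_of_forall_pos_le_add fun ε hε _ => ?_) zero_le
  have hε0 : (ε : ℝ≥0∞) ≠ 0 := by exact_mod_cast hε.ne'
  obtain ⟨ρ, hρ, hle⟩ := exists_coupling_of_essDistZero hr hmass hL₁ hL₂ h
    (ε := (ε : ℝ≥0∞) ^ r) (by
      rw [Ne, ENNReal.rpow_eq_zero_iff_of_pos hr0]
      exact hε0)
  rw [zero_add]
  refine (iInf₂_le ρ hρ).trans ?_
  change eLpNorm _ _ _ ≤ _
  rw [eLpNorm_eq_lintegral_rpow_enorm_toReal (ENNReal.ofReal_pos.2 hr0).ne'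
    ENNReal.ofReal_ne_top, ENNReal.toReal_ofReal hr0.le, one_div]
  refine (ENNReal.rpow_le_rpow hle (by positivity)).trans_eq ?_
  exact ENNReal.rpow_rpow_inv hr0.ne' _

/-- Adjoining a half-line is itself an elementary equivalence and makes both masses infinite, so
unequal masses reduce to the case of equal ones. -/
theorem lpDist_eq_zero_of_linked {r : ℝ} (hr : 1 ≤ r)
    (hL : MemLp W₁.toFun (ENNReal.ofReal r) W₁.sqMeasure) (h : Linked W₁ W₂) :
    lpDist (ENNReal.ofReal r) W₁ W₂ = 0 := by
  have hq : 1 ≤ ENNReal.ofReal r := ENNReal.one_le_ofReal.2 hr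
  obtain ⟨hd, hL₂⟩ := Linked.essDistZero hq ENNReal.ofReal_ne_top hL h
  unfold lpDist invariantDist
  split_ifs with hm
  · exact couplingInf_eq_zero_of_essDistZero hr hm hL hL₂ hd
  · have t₁ : Linked W₁.addHalfLine W₁ := (isTrivialExtension_addHalfLine W₁).linked.symm
    have t₂ : Linked W₂ W₂.addHalfLine := (isTrivialExtension_addHalfLine W₂).linked
    have hL' := (isTrivialExtension_addHalfLine W₁).memLp_iff.1 hL
    obtain ⟨hd', hL₂'⟩ :=
      Linked.essDistZero hq ENNReal.ofReal_ne_top hL' ((t₁.trans h).trans t₂)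
    exact couplingInf_eq_zero_of_essDistZero hr
      ((addHalfLine_univ W₁).trans (addHalfLine_univ W₂).symm) hL' hL₂' hd'

end Recoupling

/-! ### Comparison of the distances and the equivalences -/

section Main

variable {W₁ W₂ : Graphon.{u}}

lemma linked_of_invariantDist_eq_zero
    {N : ∀ {X : Type u} [MeasurableSpace X], Measure X → (X × X → ℝ) → ℝ≥0∞}
    (hN : ∀ W W' : Graphon.{u}, couplingInf N W W' = 0 → Linked W W')
    (h : invariantDist N W₁ W₂ = 0) : Linked W₁ W₂ := by
  unfold invariantDist at h
  split_ifs at h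
  · exact hN _ _ h
  · exact ((isTrivialExtension_addHalfLine W₁).linked.trans (hN _ _ h)).trans
      (isTrivialExtension_addHalfLine W₂).linked.symm

lemma cutNorm_le_sqLpNorm_one {X : Type u} [MeasurableSpace X] (μ : Measure X) (F : X × X → ℝ) :
    cutNorm μ F ≤ sqLpNorm 1 μ F := by
  rw [sqLpNorm, eLpNorm_one_eq_lintegral_enorm]
  refine iSup_le fun T => iSup_le fun _ => iSup_le fun U => iSup_le fun _ => ?_
  exact (enorm_integral_le_lintegral_enorm _).trans (setLIntegral_le_lintegral _ _)

lemma couplingInf_mono {N N' : ∀ {X : Type u} [MeasurableSpace X], Measure X → (X × X → ℝ) → ℝ≥0∞}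
    (h : ∀ {X : Type u} [MeasurableSpace X] (μ : Measure X) (F : X × X → ℝ), N μ F ≤ N' μ F)
    (W W' : Graphon.{u}) : couplingInf N W W' ≤ couplingInf N' W W' :=
  iInf₂_mono fun _ _ => h _ _

lemma cutDist_le_lpDist_one (W W' : Graphon.{u}) : cutDist W W' ≤ lpDist 1 W W' := by
  unfold cutDist lpDist invariantDist
  split_ifs
  · exact couplingInf_mono cutNorm_le_sqLpNorm_one _ _
  · exact couplingInf_mono cutNorm_le_sqLpNorm_one _ _

end Main

end Graphon

theorem theorem5p6 (p : ℝ) (hp : 1 < p) (W W' : Graphon.{u})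
    (hW : 0 ≤ᵐ[W.sqMeasure] W.toFun) (hW' : 0 ≤ᵐ[W'.sqMeasure] W'.toFun)
    (hWp : MemLp W.toFun (ENNReal.ofReal p) W.sqMeasure)
    (hWp' : MemLp W'.toFun (ENNReal.ofReal p) W'.sqMeasure) :
    List.TFAE [
      Graphon.Equivalent W W',
      Graphon.cutDist W W' = 0,
      Graphon.lpDist 1 W W' = 0,
      Graphon.ElemChain W W',
      Graphon.lpDist (ENNReal.ofReal p) W W' = 0] := by
  tfae_have 1 ↔ 2 := Iff.rfl
  tfae_have 3 → 2 := fun h => le_antisymm ((Graphon.cutDist_le_lpDist_one W W').trans_eq h) zero_le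
  tfae_have 2 → 4 := fun h => Graphon.elemChain_iff_linked.2
    (Graphon.linked_of_invariantDist_eq_zero
      (fun _ _ => Graphon.linked_of_couplingInf_cutNorm_eq_zero) h)
  tfae_have 5 → 4 := fun h => Graphon.elemChain_iff_linked.2
    (Graphon.linked_of_invariantDist_eq_zero
      (fun _ _ => Graphon.linked_of_couplingInf_sqLpNorm_eq_zero hp) h)
  tfae_have 4 → 5 := fun h =>
    Graphon.lpDist_eq_zero_of_linked hp.le hWp (Graphon.elemChain_iff_linked.1 h)
  -- The case `r = 1`, where membership in `L¹` is part of being a graphon.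
  tfae_have 4 → 3 := fun h => by
    have h1 := Graphon.lpDist_eq_zero_of_linked (r := 1) le_rfl
      (by rw [ENNReal.ofReal_one]; exact memLp_one_iff_integrable.2 W.integrable)
      (Graphon.elemChain_iff_linked.1 h)
    rwa [ENNReal.ofReal_one] at h1
  tfae_finish
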